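/- **Setting.** Let $d\ge 1$, $p\in[1,\infty]$, $X=\mathbb{R}^d$ with the $\ell_p$-distance $\mathrm{dist}$, $Y=\{0,1\}$, $r>0$, $\gamma>0$, and let $\mathcal U(x)=\{z:\mathrm{dist}(x,z)\le r\}$, $\mathcal V(x)=\{z:\mathrm{dist}(x,z)\le(1+\gamma)r\}$. For a perturbation type $\mathcal T:X\to 2^X$ and $h:X\to Y$ put $\ell^{\mathcal T}(h,x,y)=\max_{z\in\mathcal T(x)}\mathbf 1[h(z)\ne y]$; let $L^{\mathcal T}_P(h)$ be its expectation under a probability measure $P$ on $X\times Y$ (the outer measure of $\{\ell^{\mathcal T}=1\}$ if that set is not measurable), $L^{\mathcal T}_S(h)$ its average over a sample $S$, and $L^{\mathcal T}_P(\mathcal H)=\inf_{h\in\mathcal H}L^{\mathcal T}_P(h)$. An RERM oracle for $(\mathcal H,\mathcal T)$ returns, for each sample $S$, some $h\in\mathcal H$ minimizing $L^{\mathcal T}_S$ over $\mathcal H$. $\mathrm{VC}(\mathcal H)$ is the VC-dimension, and $\mathrm{VC}_{\mathcal V}(\mathcal H)$ is the supremum of $|K|$ over finite $K\subseteq X$ such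 that for every $y\in\{0,1\}^K$ some $h\in\mathcal H$ satisfies $h(z)=y(x)$ for all $x\in K$, $z\in\mathcal V(x)$. **Algorithm.** Input: labeled data $S_l$ of size $m$, unlabeled data $S_u=(x_1,\dots,x_n)$, an RERM oracle $\mathcal A$ for $(\mathcal H,\mathcal V)$, and an $r\gamma$-cover $C$ of $X$ (every $x\in X$ has some $c\in C$ with $\mathrm{dist}(x,c)\le r\gamma$). For every $y\in\{0,1\}^n$ let $S_u^y=((x_1,y_1),\dots,(x_n,y_n))$ and $h'=\mathcal A(S_u^y)$, and put $h'$ into $\mathcal H'$ if $L^{\mathcal V}_{S_u^y}(h')=0$. Let $\mathcal C(x)=C\cap\mathcal V(x)$ and let $\hat h$ be an RERM output for $(\mathcal H',\mathcal C)$ on $S_l$ (any minimizer). Output $\mathrm{nn}_C(\hat h)$, which gives each $x$ the label $\hat h(z)$ of some nearest point $z\in C$ of $x$ (ties broken arbitrarily; the output is arbitrary if $\mathcal H'=\emptyset$). **Theorem.** (1) The grid $\left(\tfrac{2r\gamma}{d}\mathbb Z\right)^d$ is an $r\gamma$-cover of $X$, and it satisfies $|\mathcal C(x)|\le\left(2d(1+1/\gamma)\right)^d$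 for all $x$. (2) For every $K>0$ there are $c>0$ and $a\in\mathbb N$, depending only on $K$, such that with $\tilde O(f):=c\,f\log^a(2+f)$ the following holds for all $d,p,r,\gamma$ as above, every class $\mathcal H$ with $\mathrm{VC}(\mathcal H)<\infty$, every $r\gamma$-cover $C$ with $|\mathcal C(x)|\le (Kd(1+1/\gamma))^d$ for all $x$, every RERM oracle for $(\mathcal H,\mathcal V)$, every implementation of the algorithm, every probability measure $P$ on $X\times Y$ with $L^{\mathcal V}_P(\mathcal H)=0$, and all $\epsilon,\delta\in(0,1)$. If $S_u$ consists of $n$ i.i.d. points from the marginal of $P$ on $X$ and $S_l$ of $m$ i.i.d. labeled points from $P$, independent of $S_u$, where $$n\ \ge\ \tilde O\!\left(\frac{\mathrm{VC}(\mathcal H)\left(d\log(2+1/\gamma)+\log d\right)+\log(1/\delta)}{\epsilon}\right),\qquad m\ \ge\ \tilde O\!\left(\frac{\mathrm{VC}_{\mathcal V}(\mathcal H)\log n+\log(1/\delta)}{\epsilon^2}\right),$$ then with probability at least $1-\delta$ over $(S_u,S_l)$ the output $g$ satisfies $L^{\mathcal U}_P(g)\le L^{\mathcal V}_P(\mathcal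 H)+\epsilon$. Here the probability of failure is bounded by $\delta$ for the joint law whenever the failure event is measurable, and in every case as an iterated upper integral (first over $S_l$, then over $S_u$). -/

import Mathlib

open MeasureTheory
open scoped ENNReal

namespace TolerantSSL

/-- A binary classifier on `X` (label `0` is `false`, label `1` is `true`). -/
abbrev Hypothesis (X : Type*) := X → Bool

/-- A perturbation type assigns to every point its set of admissible perturbations. -/
abbrev PerturbationType (X : Type*) := X → Set X

/-- A labelled sample of size `n`. -/
abbrev Sample (X : Type*) (n : ℕ) := Fin n → X × Bool

section Losses

variable {X : Type*}

/-- The 0-1 loss of `h` at `(x, y)`. -/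
def zeroOneLoss (h : Hypothesis X) (x : X) (y : Bool) : ℝ≥0∞ :=
  if h x = y then 0 else 1

/-- The adversarial loss, the largest 0-1 loss over the perturbations of `x`. -/
noncomputable def advLoss (U : PerturbationType X) (h : Hypothesis X) (x : X) (y : Bool) : ℝ≥0∞ :=
  ⨆ z ∈ U x, zeroOneLoss h z y

/-- The set of labelled points on which the adversarial loss equals one. -/
def lossSet (U : PerturbationType X) (h : Hypothesis X) : Set (X × Bool) :=
  {p | advLoss U h p.1 p.2 = 1}

/-- The expected adversarial loss. The loss is 0-1 valued, so its expectation is the measure of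
the loss set (see `advRisk_eq_lintegral`). If the loss set is not measurable, this is its outer
measure, so no measurability of the hypothesis is needed. -/
noncomputable def advRisk [MeasurableSpace X] (U : PerturbationType X) (P : Measure (X × Bool))
    (h : Hypothesis X) : ℝ≥0∞ :=
  P (lossSet U h)

/-- The empirical adversarial loss. -/
noncomputable def empAdvRisk (U : PerturbationType X) {n : ℕ} (S : Sample X n)
    (h : Hypothesis X) : ℝ≥0∞ :=
  (∑ i, advLoss U h (S i).1 (S i).2) / (n : ℝ≥0∞)

/-- The adversarial approximation error of a class. -/
noncomputable def approxError [MeasurableSpace X] (U : PerturbationType X)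
    (P : Measure (X × Bool)) (H : Set (Hypothesis X)) : ℝ≥0∞ :=
  ⨅ h ∈ H, advRisk U P h

theorem advLoss_eq_zero_or_one (U : PerturbationType X) (h : Hypothesis X) (x : X) (y : Bool) :
    advLoss U h x y = 0 ∨ advLoss U h x y = 1 := by
  by_cases hz : ∃ z ∈ U x, h z ≠ y
  · right
    obtain ⟨z, hzU, hne⟩ := hz
    apply le_antisymm
    · refine iSup₂_le fun w _ => ?_
      unfold zeroOneLoss
      split_ifs <;> simp
    · have : zeroOneLoss h z y = 1 := by simp [zeroOneLoss, hne]
      rw [← this]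
      exact le_iSup₂ (f := fun w (_ : w ∈ U x) => zeroOneLoss h w y) z hzU
  · left
    push Not at hz
    unfold advLoss
    simp only [ENNReal.iSup_eq_zero]
    intro z hzU
    simp [zeroOneLoss, hz z hzU]

theorem advRisk_eq_lintegral [MeasurableSpace X] (U : PerturbationType X)
    (P : Measure (X × Bool)) (h : Hypothesis X) (hm : NullMeasurableSet (lossSet U h) P) :
    advRisk U P h = ∫⁻ p, advLoss U h p.1 p.2 ∂P := by
  have : (fun p : X × Bool => advLoss U h p.1 p.2) = (lossSet U h).indicator 1 := by
    funext p
    by_cases hp : p ∈ lossSet U h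
    · rw [Set.indicator_of_mem hp]; exact hp
    · rw [Set.indicator_of_notMem hp]
      exact (advLoss_eq_zero_or_one U h p.1 p.2).resolve_right hp
  rw [this, lintegral_indicator_one₀ hm]
  rfl

end Losses

section Dimensions

variable {X : Type*}

/-- `H` shatters the finite set `K`: every labelling of `K` is realized by some `h ∈ H`. -/
def Shatters (H : Set (Hypothesis X)) (K : Finset X) : Prop :=
  ∀ y : X → Bool, ∃ h ∈ H, ∀ x ∈ K, h x = y x

/-- The VC-dimension. -/
noncomputable def vcDim (H : Set (Hypothesis X)) : ℕ∞ :=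
  ⨆ K : {K : Finset X // Shatters H K}, (K.1.card : ℕ∞)

/-- `H` `U`-shatters `K`: every labelling of `K` is realized by some `h ∈ H` that is constant, with
the prescribed label, on each `U x`, `x ∈ K`. -/
def RobustlyShatters (U : PerturbationType X) (H : Set (Hypothesis X)) (K : Finset X) : Prop :=
  ∀ y : X → Bool, ∃ h ∈ H, ∀ x ∈ K, ∀ z ∈ U x, h z = y x

/-- The `VC_U`-dimension. -/
noncomputable def robustVCDim (U : PerturbationType X) (H : Set (Hypothesis X)) : ℕ∞ :=
  ⨆ K : {K : Finset X // RobustlyShatters U H K}, (K.1.card : ℕ∞)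

/-- `VC_U ≤ VC`; in particular `VC_U` is finite as soon as `VC` is. -/
theorem robustVCDim_le_vcDim (U : PerturbationType X) (hU : ∀ x, x ∈ U x)
    (H : Set (Hypothesis X)) : robustVCDim U H ≤ vcDim H := by
  refine iSup_le fun K => ?_
  have hK : Shatters H K.1 := fun y => by
    obtain ⟨h, hH, hh⟩ := K.2 y
    exact ⟨h, hH, fun x hx => hh x hx x (hU x)⟩
  exact le_iSup (fun K : {K : Finset X // Shatters H K} => (K.1.card : ℕ∞)) ⟨K.1, hK⟩

end Dimensions

section Learner

variable {X : Type*}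

/-- `h` is a possible output of RERM for the class `H` and the type `V` on the sample `S`. -/
def IsRERM (V : PerturbationType X) (H : Set (Hypothesis X)) {n : ℕ} (S : Sample X n)
    (h : Hypothesis X) : Prop :=
  h ∈ H ∧ ∀ h' ∈ H, empAdvRisk V S h ≤ empAdvRisk V S h'

/-- `A` is an RERM oracle for the class `H` and the type `V`. -/
def IsRERMOracle (V : PerturbationType X) (H : Set (Hypothesis X))
    (A : (n : ℕ) → Sample X n → Hypothesis X) : Prop :=
  ∀ (n : ℕ) (S : Sample X n), IsRERM V H S (A n S)

/-- The unlabelled sample `Su` with the labels `y` attached. -/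
def labelled {n : ℕ} (Su : Fin n → X) (y : Fin n → Bool) : Sample X n :=
  fun i => (Su i, y i)

/-- The class `H'`: run the oracle on every labelling of `Su` and keep the outputs
that have empirical adversarial loss zero on the labelling they were computed from. -/
def candidates (V : PerturbationType X) (A : (n : ℕ) → Sample X n → Hypothesis X) {n : ℕ}
    (Su : Fin n → X) : Set (Hypothesis X) :=
  {h' | ∃ y : Fin n → Bool, h' = A n (labelled Su y) ∧ empAdvRisk V (labelled Su y) h' = 0}

/-- The discrete perturbation type `x ↦ C ∩ V x`. -/
def discretized (V : PerturbationType X) (C : Set X) : PerturbationType X :=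
  fun x => C ∩ V x

/-- `g` is a `C`-nearest-neighbour discretization of `h`, with ties broken arbitrarily. -/
def IsNNDiscretization [MetricSpace X] (C : Set X) (h g : Hypothesis X) : Prop :=
  ∀ x, ∃ z ∈ C, (∀ c ∈ C, dist x z ≤ dist x c) ∧ g x = h z

/-- `g` is a possible output of the semi-supervised learner on labelled data `Sl` and unlabelled
data `Su`, with RERM oracle `A` for the type `V` and discretization `C`. When no labelling of `Su`
is robustly realizable there is no candidate, and the output is unconstrained. -/
def IsSSLOutput [MetricSpace X] (V : PerturbationType X) (C : Set X)
    (A : (n : ℕ) → Sample X n → Hypothesis X) {m n : ℕ}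
    (Sl : Sample X m) (Su : Fin n → X) (g : Hypothesis X) : Prop :=
  (candidates V A Su).Nonempty →
    ∃ h : Hypothesis X, IsRERM (discretized V C) (candidates V A Su) Sl h ∧
      IsNNDiscretization C h g

/-- `L` implements the semi-supervised learner. -/
def ImplementsSSL [MetricSpace X] (V : PerturbationType X) (C : Set X)
    (A : (n : ℕ) → Sample X n → Hypothesis X)
    (L : (m n : ℕ) → Sample X m → (Fin n → X) → Hypothesis X) : Prop :=
  ∀ (m n : ℕ) (Sl : Sample X m) (Su : Fin n → X), IsSSLOutput V C A Sl Su (L m n Sl Su)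

/-- `C` is a `ρ`-cover of `X`. -/
def IsCoverOf [MetricSpace X] (ρ : ℝ) (C : Set X) : Prop :=
  ∀ x : X, ∃ c ∈ C, dist x c ≤ ρ

/-- The event that the risk of the learner with respect to `U` exceeds the approximation error with
respect to `V` by more than `ε`, as a set of pairs (unlabelled sample, labelled sample). -/
def failure [MeasurableSpace X] (U V : PerturbationType X) (H : Set (Hypothesis X))
    (P : Measure (X × Bool)) (L : (m n : ℕ) → Sample X m → (Fin n → X) → Hypothesis X)
    (ε : ℝ) (m n : ℕ) : Set ((Fin n → X) × Sample X m) :=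
  {S | approxError V P H + ENNReal.ofReal ε < advRisk U P (L m n S.2 S.1)}

end Learner

/-- `ℝ^d` with the `ℓ_p` norm. -/
abbrev Space (p : ℝ≥0∞) (d : ℕ) := PiLp p (fun _ : Fin d => ℝ)

/-- Balls of radius `ρ` as perturbation sets. -/
def ballType {X : Type*} [MetricSpace X] (ρ : ℝ) : PerturbationType X :=
  fun x => Metric.closedBall x ρ

/-- The evenly spaced grid of side length `s`. -/
def grid (p : ℝ≥0∞) (d : ℕ) (s : ℝ) : Set (Space p d) :=
  {x | ∀ i, ∃ z : ℤ, x i = (z : ℝ) * s}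

/-- `f · log(2 + f) ^ a`; a quantity is `Õ(f)` if it is at most a constant times this, for some
exponent `a`. -/
noncomputable def polylog (a : ℕ) (f : ℝ) : ℝ :=
  f * Real.log (2 + f) ^ a

/-- The main term of the unlabelled sample complexity, with `v` the VC-dimension. -/
noncomputable def unlabelledRate (v d : ℕ) (γ ε δ : ℝ) : ℝ :=
  ((v : ℝ) * ((d : ℝ) * Real.log (2 + 1 / γ) + Real.log d) + Real.log (1 / δ)) / ε

/-- The main term of the labelled sample complexity, with `w` the `VC_V`-dimension and `n` the
number of unlabelled points. -/
noncomputable def labelledRate (w n : ℕ) (ε δ : ℝ) : ℝ :=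
  ((w : ℝ) * Real.log n + Real.log (1 / δ)) / ε ^ 2

end TolerantSSL

/-! Realizability provides `h₀ ∈ H` of tiny robust risk, so with high probability `h₀` is constant
on every `V x` for `x` in the unlabelled sample. One of the labellings tried is that of `h₀`. On it
the oracle returns a candidate `h'` that agrees with `h₀` on all these sets. Seen only through the
finite sets `C ∩ V x`, with at most `N` points each, the regions where members of `H` differ from
`h₀` have at most `(2nN+1)^v` traces on a double sample (Sauer-Shelah). The ε-net bound
`measure_exists_consistent_mul_le` then makes the disagreement of `h'` with `h₀` small, so `h'` has
small discretized risk (`exists_unlabelled_exceptional_set`).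

Labellings kept by the algorithm are robustly realized, so Sauer-Shelah with `VC_V` leaves at most
`(n+1)^w` candidates (`exists_finset_candidates`). A Chernoff and union bound over this finite
class, fixed once the unlabelled data are fixed, handles the labelled sample
(`measure_labelled_failure_le`). Rounding to the nearest cover point turns discretized risk into
risk for the smaller balls (`lossSet_subset_of_isNNDiscretization`).

Hypotheses are arbitrary functions: `C` is countable, so all discretized events are countable unions
of measurable sets. -/

namespace TolerantSSL

/-! ### Symmetrization, the ε-net bound and a Chernoff bound -/

section Probability

theorem lintegral_pi_prod_eq_pow {Z : Type*} [MeasurableSpace Z] (μ : Measure Z)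
    [IsProbabilityMeasure μ] {f : Z → ℝ≥0∞} (hf : Measurable f) (n : ℕ) :
    ∫⁻ z, ∏ i, f (z i) ∂(Measure.pi fun _ : Fin n => μ) = (∫⁻ x, f x ∂μ) ^ n := by
  induction n with
  | zero => simp
  | succ n ih =>
    have := ((measurePreserving_piFinSuccAbove (fun _ : Fin (n + 1) => μ) 0).symm)
    rw [← this.lintegral_comp (by fun_prop)]
    simp_rw [MeasurableEquiv.piFinSuccAbove_symm_apply, Fin.insertNthEquiv,
      Fin.prod_univ_succ, Fin.insertNth_zero]
    simp only [Equiv.coe_fn_mk, Fin.cons_zero, Fin.cons_succ]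
    change ∫⁻ a : Z × (Fin n → Z), f a.1 * ∏ x, f (a.2 x) ∂_ = _
    rw [lintegral_prod_mul (f := f) (g := fun z : Fin n → Z => ∏ x, f (z x)) hf.aemeasurable
      (by fun_prop : Measurable _).aemeasurable, ih, pow_succ']

/-- The one-sided weight of a pair: `0` if the first point lies in `D`, otherwise `2` or `1`
according to whether the second point lies in `D`. -/
noncomputable def pairWeight {X : Type*} (D : Set X) (q : X × X) : ℝ≥0∞ :=
  Dᶜ.indicator 1 q.1 * (1 + D.indicator 1 q.2)

theorem measurable_pairWeight {X : Type*} [MeasurableSpace X] {D : Set X} (hD : MeasurableSet D) :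
    Measurable (pairWeight D) := by
  have h1 : Measurable (Dᶜ.indicator (1 : X → ℝ≥0∞)) := measurable_one.indicator hD.compl
  have h2 : Measurable (D.indicator (1 : X → ℝ≥0∞)) := measurable_one.indicator hD
  unfold pairWeight
  fun_prop

/-- The two orders give `2 + 0` if one point lies in `D`, `1 + 1` if none does, and `0 + 0` if both
do. A random swap therefore has mean weight at most one. -/
theorem pairWeight_add_swap_le {X : Type*} (D : Set X) (q : X × X) :
    pairWeight D q + pairWeight D q.swap ≤ 2 := by
  classical
  unfold pairWeight
  by_cases h1 : q.1 ∈ D <;> by_cases h2 : q.2 ∈ D <;> simp [h1, h2, one_add_one_eq_two]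

/-- Swap the two entries of the pairs selected by `σ`. -/
def swapBy {X : Type*} {n : ℕ} (σ : Fin n → Bool) (z : Fin n → X × X) : Fin n → X × X :=
  fun i => if σ i then (z i).swap else z i

theorem sum_prod_swapBy_le {X : Type*} {n : ℕ} (D : Set X) (z : Fin n → X × X) :
    ∑ σ : Fin n → Bool, ∏ i, pairWeight D (swapBy σ z i) ≤ 2 ^ n := by
  calc ∑ σ : Fin n → Bool, ∏ i, pairWeight D (swapBy σ z i)
      = ∏ i : Fin n, ∑ b : Bool, pairWeight D (if b then (z i).swap else z i) := by
        rw [Finset.prod_univ_sum, Fintype.piFinset_univ]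
        rfl
    _ ≤ ∏ _i : Fin n, 2 := by
        gcongr with i
        simp only [Fintype.sum_bool]
        simpa [add_comm] using pairWeight_add_swap_le D (z i)
    _ = 2 ^ n := by simp

theorem measurePreserving_swapBy {X : Type*} [MeasurableSpace X] (μ : Measure X)
    [IsProbabilityMeasure μ] {n : ℕ} (σ : Fin n → Bool) :
    MeasurePreserving (swapBy (X := X) σ) (Measure.pi fun _ : Fin n => μ.prod μ)
      (Measure.pi fun _ : Fin n => μ.prod μ) := by
  refine measurePreserving_pi (fun _ : Fin n => μ.prod μ) (fun _ : Fin n => μ.prod μ)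
    (f := fun i q => if σ i then q.swap else q) fun i => ?_
  by_cases h : σ i
  · simpa [h] using Measure.measurePreserving_swap (μ := μ) (ν := μ)
  · simp only [h]
    exact MeasurePreserving.id _

/-- Symmetrization: the expected maximal weight is at most the number of traces on a
double sample. -/
theorem lintegral_iSup_pairWeight_le {X ι : Type*} [MeasurableSpace X] (μ : Measure X)
    [IsProbabilityMeasure μ] (I : Finset ι) (D : ι → Set X) (hD : ∀ i, MeasurableSet (D i))
    {n : ℕ} {G : ℝ≥0∞}
    (hG : ∀ z : Fin n → X × X, ∃ T : Finset ι, (T.card : ℝ≥0∞) ≤ G ∧ ∀ i ∈ I, ∃ j ∈ T, ∀ k,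
      ((z k).1 ∈ D i ↔ (z k).1 ∈ D j) ∧ ((z k).2 ∈ D i ↔ (z k).2 ∈ D j)) :
    ∫⁻ z, ⨆ i ∈ I, ∏ k, pairWeight (D i) (z k) ∂(Measure.pi fun _ : Fin n => μ.prod μ) ≤ G := by
  classical
  set ν := Measure.pi fun _ : Fin n => μ.prod μ
  set F : (Fin n → X × X) → ℝ≥0∞ := fun z => ⨆ i ∈ I, ∏ k, pairWeight (D i) (z k) with hF
  have hFm : Measurable F := by
    refine Measurable.biSup _ I.countable_toSet fun i _ => ?_
    have := measurable_pairWeight (hD i)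
    fun_prop
  -- Swapping does not change which points occur, so the representatives `T` for `z` serve all `σ`
  -- at once, and the maximum is bounded by a sum over `T`.
  have hpt : ∀ z, ∑ σ : Fin n → Bool, F (swapBy σ z) ≤ 2 ^ n * G := by
    intro z
    obtain ⟨T, hT, hTI⟩ := hG z
    have hle : ∀ σ : Fin n → Bool,
        F (swapBy σ z) ≤ ∑ j ∈ T, ∏ k, pairWeight (D j) (swapBy σ z k) := by
      intro σ
      refine iSup₂_le fun i hi => ?_
      obtain ⟨j, hj, hij⟩ := hTI i hi
      have : ∀ k, pairWeight (D i) (swapBy σ z k) = pairWeight (D j) (swapBy σ z k) := by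
        intro k
        obtain ⟨h1, h2⟩ := hij k
        by_cases hσ : σ k <;>
          simp [swapBy, hσ, pairWeight, Set.indicator_apply, h1, h2]
      simp_rw [this]
      exact Finset.single_le_sum (f := fun j => ∏ k, pairWeight (D j) (swapBy σ z k))
        (fun _ _ => zero_le) hj
    calc ∑ σ : Fin n → Bool, F (swapBy σ z)
        ≤ ∑ σ : Fin n → Bool, ∑ j ∈ T, ∏ k, pairWeight (D j) (swapBy σ z k) :=
          Finset.sum_le_sum fun σ _ => hle σ
      _ = ∑ j ∈ T, ∑ σ : Fin n → Bool, ∏ k, pairWeight (D j) (swapBy σ z k) :=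
          Finset.sum_comm
      _ ≤ ∑ _j ∈ T, 2 ^ n := Finset.sum_le_sum fun j _ => sum_prod_swapBy_le (D j) z
      _ = 2 ^ n * T.card := by simp [mul_comm]
      _ ≤ 2 ^ n * G := by gcongr
  have h2n : (2 : ℝ≥0∞) ^ n * ∫⁻ z, F z ∂ν ≤ 2 ^ n * G := by
    calc (2 : ℝ≥0∞) ^ n * ∫⁻ z, F z ∂ν
        = ∑ σ : Fin n → Bool, ∫⁻ z, F (swapBy σ z) ∂ν := by
          rw [Finset.sum_congr rfl fun σ _ =>
            (measurePreserving_swapBy μ σ).lintegral_comp hFm]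
          simp [ν]
      _ = ∫⁻ z, ∑ σ : Fin n → Bool, F (swapBy σ z) ∂ν := by
          rw [lintegral_finsetSum]
          exact fun σ _ => hFm.comp (measurePreserving_swapBy μ σ).measurable
      _ ≤ ∫⁻ _z, 2 ^ n * G ∂ν := lintegral_mono hpt
      _ = 2 ^ n * G := by simp [ν]
  exact (ENNReal.mul_le_mul_iff_right (by simp) (by simp)).1 h2n

/-- The `ε`-net bound for a finite family of sets with few traces on double samples. -/
theorem measure_exists_missed_mul_le {X ι : Type*} [MeasurableSpace X] (μ : Measure X)
    [IsProbabilityMeasure μ] (I : Finset ι) (D : ι → Set X) (hD : ∀ i, MeasurableSet (D i))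
    {n : ℕ} {G e : ℝ≥0∞}
    (hG : ∀ z : Fin n → X × X, ∃ T : Finset ι, (T.card : ℝ≥0∞) ≤ G ∧ ∀ i ∈ I, ∃ j ∈ T, ∀ k,
      ((z k).1 ∈ D i ↔ (z k).1 ∈ D j) ∧ ((z k).2 ∈ D i ↔ (z k).2 ∈ D j)) :
    (1 + e) ^ n * (Measure.pi fun _ : Fin n => μ) {S | ∃ i ∈ I, e ≤ μ (D i) ∧ ∀ k, S k ∉ D i}
      ≤ G := by
  classical
  refine le_trans ?_ (lintegral_iSup_pairWeight_le μ I D hD hG)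
  have hmp := (measurePreserving_arrowProdEquivProdArrow X X (Fin n) (fun _ => μ) (fun _ => μ)).symm
  have hFm : Measurable fun z : Fin n → X × X => ⨆ i ∈ I, ∏ k, pairWeight (D i) (z k) := by
    refine Measurable.biSup _ I.countable_toSet fun i _ => ?_
    have := measurable_pairWeight (hD i)
    fun_prop
  have hFm' := hFm.comp hmp.measurable
  rw [Function.comp_def] at hFm'
  rw [← hmp.lintegral_comp hFm, lintegral_prod _ hFm'.aemeasurable]
  have hm2 := hFm'.lintegral_prod_right' (ν := Measure.pi fun _ : Fin n => μ)
  -- Markov in the first half-sample `S`: if `S` misses a set of measure at least `e`, integrating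
  -- the weight over the second half already gives `(1 + e) ^ n`.
  refine le_trans ?_ (mul_meas_ge_le_lintegral hm2 ((1 + e) ^ n))
  refine mul_le_mul' le_rfl (measure_mono ?_)
  rintro S ⟨i, hi, hei, hS⟩
  have hind : Measurable ((D i).indicator (1 : X → ℝ≥0∞)) := measurable_one.indicator (hD i)
  calc (1 + e) ^ n ≤ (∫⁻ x, (1 + (D i).indicator 1 x) ∂μ) ^ n := by
        gcongr
        rw [lintegral_add_left measurable_const, lintegral_indicator_one (hD i)]
        simpa using hei
    _ = ∫⁻ T, ∏ k, (1 + (D i).indicator 1 (T k)) ∂(Measure.pi fun _ : Fin n => μ) :=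
        (lintegral_pi_prod_eq_pow μ (by fun_prop) n).symm
    _ ≤ _ := by
        refine lintegral_mono fun T => ?_
        refine le_trans (le_of_eq ?_) (le_iSup₂ (f := fun i (_ : i ∈ I) =>
          ∏ k, pairWeight (D i) ((MeasurableEquiv.arrowProdEquivProdArrow X X (Fin n)).symm
            (S, T) k)) i hi)
        refine Finset.prod_congr rfl fun k _ => ?_
        simp [pairWeight, MeasurableEquiv.arrowProdEquivProdArrow,
          Equiv.arrowProdEquivProdArrow, hS k]

theorem exp_le_one_add_add_sq {x : ℝ} (hx : |x| ≤ 1) : Real.exp x ≤ 1 + x + x ^ 2 := by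
  have := (abs_le.1 (Real.abs_exp_sub_one_sub_id_le hx)).2
  linarith

/-- If `A` is more likely than `B` by `ε / 2`, it is unlikely that `A` occurs no more often. -/
theorem measure_sum_indicator_le_le {Z : Type*} [MeasurableSpace Z] (P : Measure Z)
    [IsProbabilityMeasure P] {A B : Set Z} (hA : MeasurableSet A) (hB : MeasurableSet B)
    {ε : ℝ} (h0 : 0 < ε) (h1 : ε < 1) (hPB : P B ≤ ENNReal.ofReal (ε / 2))
    (hPA : ENNReal.ofReal ε ≤ P A) (m : ℕ) :
    (Measure.pi fun _ : Fin m => P)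
        {S | ∑ i, A.indicator (1 : Z → ℝ≥0∞) (S i) ≤ ∑ i, B.indicator (1 : Z → ℝ≥0∞) (S i)}
      ≤ ENNReal.ofReal (Real.exp (-(m * ε ^ 2 / 16))) := by
  classical
  set X : Z → ℝ := fun z => B.indicator 1 z - A.indicator 1 z with hX
  have hXm : Measurable X :=
    (measurable_one.indicator hB).sub (measurable_one.indicator hA)
  have hXb : ∀ z, |X z| ≤ 1 := by
    intro z
    by_cases hz : z ∈ A <;> by_cases hz' : z ∈ B <;> simp [hX, hz, hz']
  -- The mean of `X` is at most `-ε/2`, so the bound `1 - tε/2 + t²` for the moment generating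
  -- function is optimal at `t = ε/4`, with value `1 - ε²/16`.
  set φ : Z → ℝ≥0∞ := fun z => ENNReal.ofReal (Real.exp (ε / 4 * X z)) with hφ
  have hφm : Measurable φ := by fun_prop
  have hint : ∀ C : Set Z, MeasurableSet C → Integrable (C.indicator (1 : Z → ℝ)) P :=
    fun C hC => (integrable_const (1 : ℝ)).indicator hC
  have hXi : Integrable X P := (hint B hB).sub (hint A hA)
  have hXint : ∫ z, X z ∂P ≤ -(ε / 2) := by
    rw [integral_sub (hint B hB) (hint A hA), integral_indicator_one hB, integral_indicator_one hA]
    have hb : P.real B ≤ ε / 2 := ENNReal.toReal_le_of_le_ofReal (by linarith) hPB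
    have ha : ε ≤ P.real A := (ENNReal.ofReal_le_iff_le_toReal (measure_ne_top _ _)).1 hPA
    linarith
  have hφint : ∫⁻ z, φ z ∂P ≤ ENNReal.ofReal (Real.exp (-(ε ^ 2 / 16))) := by
    have hint2 : Integrable (fun z => 1 + ε / 4 * X z + (ε / 4) ^ 2) P :=
      ((integrable_const 1).add (hXi.const_mul _)).add (integrable_const _)
    have hptw : ∀ z, Real.exp (ε / 4 * X z) ≤ 1 + ε / 4 * X z + (ε / 4) ^ 2 := by
      intro z
      have hz := hXb z
      have h2 : |ε / 4 * X z| ≤ 1 := by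
        rw [abs_mul, abs_of_pos (by linarith : 0 < ε / 4)]
        nlinarith [abs_nonneg (X z)]
      have h3 : (X z) ^ 2 ≤ 1 := by rw [← sq_abs]; nlinarith [abs_nonneg (X z)]
      have h4 := exp_le_one_add_add_sq h2
      nlinarith [sq_nonneg (ε / 4)]
    calc ∫⁻ z, φ z ∂P ≤ ∫⁻ z, ENNReal.ofReal (1 + ε / 4 * X z + (ε / 4) ^ 2) ∂P :=
          lintegral_mono fun z => ENNReal.ofReal_le_ofReal (hptw z)
      _ = ENNReal.ofReal (∫ z, (1 + ε / 4 * X z + (ε / 4) ^ 2) ∂P) :=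
          (ofReal_integral_eq_lintegral_ofReal hint2
            (ae_of_all _ fun z => (Real.exp_pos _).le.trans (hptw z))).symm
      _ ≤ _ := by
          apply ENNReal.ofReal_le_ofReal
          have hi1 : Integrable (fun z => 1 + ε / 4 * X z) P :=
            (integrable_const 1).add (hXi.const_mul _)
          rw [integral_add hi1 (integrable_const _),
            integral_add (integrable_const 1) (hXi.const_mul _), integral_const_mul]
          have := Real.add_one_le_exp (-(ε ^ 2 / 16))
          simp only [integral_const, probReal_univ, smul_eq_mul]
          nlinarith
  calc _ ≤ (Measure.pi fun _ : Fin m => P) {S | 1 ≤ ∏ i, φ (S i)} := by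
        apply measure_mono
        intro S hS
        have hS' : ∑ i, A.indicator (1 : Z → ℝ) (S i) ≤ ∑ i, B.indicator (1 : Z → ℝ) (S i) := by
          have hofR : ∀ C : Set Z, ∑ i, C.indicator (1 : Z → ℝ≥0∞) (S i)
              = ENNReal.ofReal (∑ i, C.indicator (1 : Z → ℝ) (S i)) := by
            intro C
            rw [ENNReal.ofReal_sum_of_nonneg fun i _ => Set.indicator_nonneg (by simp) _]
            refine Finset.sum_congr rfl fun i _ => ?_
            by_cases hi : S i ∈ C <;> simp [hi]
          rw [Set.mem_ofPred_eq, hofR, hofR] at hS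
          exact (ENNReal.ofReal_le_ofReal_iff
            (Finset.sum_nonneg fun i _ => Set.indicator_nonneg (by simp) _)).1 hS
        change 1 ≤ ∏ i, φ (S i)
        rw [hφ, ← ENNReal.ofReal_prod_of_nonneg fun i _ => (Real.exp_pos _).le, ← Real.exp_sum,
          ← ENNReal.ofReal_one]
        apply ENNReal.ofReal_le_ofReal
        rw [← Finset.mul_sum]
        apply Real.one_le_exp
        apply mul_nonneg (by linarith)
        simp only [hX, Finset.sum_sub_distrib]
        linarith
    _ ≤ ∫⁻ S, ∏ i, φ (S i) ∂(Measure.pi fun _ : Fin m => P) := by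
        have := mul_meas_ge_le_lintegral (μ := Measure.pi fun _ : Fin m => P)
          (f := fun S => ∏ i, φ (S i)) (by fun_prop) 1
        simpa using this
    _ = (∫⁻ z, φ z ∂P) ^ m := lintegral_pi_prod_eq_pow P hφm m
    _ ≤ ENNReal.ofReal (Real.exp (-(ε ^ 2 / 16))) ^ m := by gcongr
    _ = _ := by
        rw [← ENNReal.ofReal_pow (Real.exp_pos _).le, ← Real.exp_nat_mul]
        ring_nf

end Probability

/-! ### Sauer-Shelah and the size of the candidate class -/

section Combinatorics

variable {X : Type*}

theorem card_le_of_vcDim_le {H : Set (Hypothesis X)} {v : ℕ} (hv : vcDim H ≤ v) {K : Finset X}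
    (hK : Shatters H K) : K.card ≤ v := by
  have := (le_iSup (fun K : {K : Finset X // Shatters H K} => (K.1.card : ℕ∞)) ⟨K, hK⟩).trans hv
  exact_mod_cast this

theorem card_le_of_robustVCDim_le {V : PerturbationType X} {H : Set (Hypothesis X)} {w : ℕ}
    (hw : robustVCDim V H ≤ w) {K : Finset X} (hK : RobustlyShatters V H K) : K.card ≤ w := by
  have := (le_iSup (fun K : {K : Finset X // RobustlyShatters V H K} => (K.1.card : ℕ∞))
    ⟨K, hK⟩).trans hw
  exact_mod_cast this

/-- A set of at most `v` elements arises from `v` choices, each inserting a point of `F` or nothing.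
-/
theorem card_powerset_filter_card_le (F : Finset X) (v : ℕ) :
    (F.powerset.filter fun s => s.card ≤ v).card ≤ (F.card + 1) ^ v := by
  classical
  induction v with
  | zero =>
    refine (Finset.card_le_card (t := {∅}) fun s hs => ?_).trans (by simp)
    simpa using (Finset.mem_filter.1 hs).2
  | succ v ih =>
    set B := F.powerset.filter fun s => s.card ≤ v
    have hsub : (F.powerset.filter fun s => s.card ≤ v + 1) ⊆
        (B ×ˢ Finset.insertNone F).image fun q : Finset X × Option X => q.2.elim q.1 fun x => insert x q.1 := by
      intro s hs
      rw [Finset.mem_filter, Finset.mem_powerset] at hs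
      rw [Finset.mem_image]
      by_cases hc : s.card ≤ v
      · exact ⟨(s, none), by simp [B, hs.1, hc], rfl⟩
      · obtain ⟨x, hx⟩ : s.Nonempty := Finset.card_pos.1 (by omega)
        refine ⟨(s.erase x, some x), ?_, by simp [Finset.insert_erase hx]⟩
        have h1 : (s.erase x).card ≤ v := by rw [Finset.card_erase_of_mem hx]; omega
        simpa [B, h1, hs.1 hx] using (Finset.erase_subset x s).trans hs.1
    calc _ ≤ _ := Finset.card_le_card hsub
      _ ≤ (B ×ˢ Finset.insertNone F).card := Finset.card_image_le
      _ = B.card * (F.card + 1) := by simp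
      _ ≤ (F.card + 1) ^ v * (F.card + 1) := by gcongr
      _ = _ := (pow_succ _ _).symm

/-- The Sauer-Shelah lemma: on a finite set, a class of VC-dimension `v` is represented by
polynomially many of its members. -/
theorem exists_finset_representatives {H : Set (Hypothesis X)} {v : ℕ}
    (hv : ∀ K : Finset X, Shatters H K → K.card ≤ v) (F : Finset X) :
    ∃ T : Finset (Hypothesis X), ↑T ⊆ H ∧ T.card ≤ (F.card + 1) ^ v ∧
      ∀ h ∈ H, ∃ t ∈ T, ∀ x ∈ F, h x = t x := by
  classical
  set tr : Hypothesis X → Finset X := fun h => F.filter fun x => h x = true with htr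
  set 𝒜 : Finset (Finset X) := F.powerset.filter fun s => ∃ h ∈ H, tr h = s with h𝒜
  have hmem : ∀ s ∈ 𝒜, ∃ h ∈ H, tr h = s := fun s hs => (Finset.mem_filter.1 hs).2
  choose! rep hrepH hrep using hmem
  have htr_mem : ∀ h ∈ H, tr h ∈ 𝒜 := fun h hh =>
    Finset.mem_filter.2 ⟨Finset.mem_powerset.2 (Finset.filter_subset _ _), h, hh, rfl⟩
  refine ⟨𝒜.image rep, ?_, ?_, ?_⟩
  · intro h hh
    obtain ⟨s, hs, rfl⟩ := Finset.mem_image.1 (Finset.mem_coe.1 hh)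
    exact hrepH s hs
  -- Pajor's inequality: a family has no more members than sets it shatters. Here each of those is
  -- shattered by `H`, so has at most `v` elements.
  · refine Finset.card_image_le.trans (𝒜.card_le_card_shatterer.trans
      ((Finset.card_le_card fun s hs => ?_).trans (card_powerset_filter_card_le F v)))
    rw [Finset.mem_shatterer] at hs
    obtain ⟨t, ht, hst⟩ := hs.exists_superset
    have hsF : s ⊆ F := hst.trans (Finset.mem_powerset.1 (Finset.mem_filter.1 ht).1)
    refine Finset.mem_filter.2 ⟨Finset.mem_powerset.2 hsF, hv s fun y => ?_⟩
    obtain ⟨u, hu, hsu⟩ := hs (Finset.filter_subset (fun x => y x = true) s)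
    obtain ⟨h, hh, rfl⟩ := (Finset.mem_filter.1 hu).2
    refine ⟨h, hh, fun x hx => ?_⟩
    have := congrArg (x ∈ ·) hsu
    simp only [htr, Finset.mem_inter, Finset.mem_filter, hx, hsF hx, true_and, eq_iff_iff] at this
    exact Bool.eq_iff_iff.2 this
  · intro h hh
    refine ⟨rep (tr h), Finset.mem_image_of_mem _ (htr_mem h hh), fun x hx => ?_⟩
    have := congrArg (x ∈ ·) (hrep _ (htr_mem h hh))
    simp only [htr, Finset.mem_filter, hx, true_and, eq_iff_iff] at this
    exact (Bool.eq_iff_iff.2 this).symm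

theorem advLoss_eq_one_iff {U : PerturbationType X} {h : Hypothesis X} {x : X} {y : Bool} :
    advLoss U h x y = 1 ↔ ∃ z ∈ U x, h z ≠ y := by
  constructor
  · intro hl
    by_contra! hc
    have : advLoss U h x y = 0 := by
      simp only [advLoss, ENNReal.iSup_eq_zero]
      intro z hz
      simp [zeroOneLoss, hc z hz]
    simp [this] at hl
  · rintro ⟨z, hz, hne⟩
    refine (advLoss_eq_zero_or_one U h x y).resolve_left fun h0 => ?_
    simp only [advLoss, ENNReal.iSup_eq_zero] at h0
    simpa [zeroOneLoss, hne] using h0 z hz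

theorem advLoss_eq_zero_iff {U : PerturbationType X} {h : Hypothesis X} {x : X} {y : Bool} :
    advLoss U h x y = 0 ↔ ∀ z ∈ U x, h z = y := by
  rcases advLoss_eq_zero_or_one U h x y with h0 | h1
  · refine ⟨fun _ => ?_, fun _ => h0⟩
    by_contra! hc
    simp [advLoss_eq_one_iff.2 hc] at h0
  · refine ⟨fun h0 => by simp [h0] at h1, fun hc => ?_⟩
    obtain ⟨z, hz, hne⟩ := advLoss_eq_one_iff.1 h1
    exact absurd (hc z hz) hne

theorem mem_lossSet_iff {U : PerturbationType X} {h : Hypothesis X} {q : X × Bool} :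
    q ∈ lossSet U h ↔ ∃ z ∈ U q.1, h z ≠ q.2 :=
  advLoss_eq_one_iff

theorem advLoss_eq_indicator (U : PerturbationType X) (h : Hypothesis X) (q : X × Bool) :
    advLoss U h q.1 q.2 = (lossSet U h).indicator 1 q := by
  by_cases hq : q ∈ lossSet U h
  · rw [Set.indicator_of_mem hq]; exact hq
  · rw [Set.indicator_of_notMem hq]
    exact (advLoss_eq_zero_or_one U h q.1 q.2).resolve_right hq

theorem empAdvRisk_eq_zero_iff {U : PerturbationType X} {n : ℕ} {S : Sample X n}
    {h : Hypothesis X} : empAdvRisk U S h = 0 ↔ ∀ i, ∀ z ∈ U (S i).1, h z = (S i).2 := by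
  simp [empAdvRisk, ENNReal.div_eq_zero_iff, advLoss_eq_zero_iff]

theorem sum_indicator_le_of_empAdvRisk_le {U : PerturbationType X} {m : ℕ} (hm : m ≠ 0)
    {S : Sample X m} {h h' : Hypothesis X} (hle : empAdvRisk U S h ≤ empAdvRisk U S h') :
    ∑ i, (lossSet U h).indicator (1 : X × Bool → ℝ≥0∞) (S i)
      ≤ ∑ i, (lossSet U h').indicator (1 : X × Bool → ℝ≥0∞) (S i) := by
  simp_rw [← advLoss_eq_indicator]
  have h1 : (m : ℝ≥0∞) ≠ 0 := by exact_mod_cast hm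
  have h2 := mul_le_mul' hle (le_refl (m : ℝ≥0∞))
  rwa [empAdvRisk, empAdvRisk, ENNReal.div_mul_cancel h1 (by simp),
    ENNReal.div_mul_cancel h1 (by simp)] at h2

/-- The candidate class is represented by few hypotheses. -/
theorem exists_finset_candidates {V : PerturbationType X} (hV : ∀ x, x ∈ V x)
    {H : Set (Hypothesis X)} {A : (n : ℕ) → Sample X n → Hypothesis X} (hA : IsRERMOracle V H A)
    {w : ℕ} (hw : robustVCDim V H ≤ w) {n : ℕ} (Su : Fin n → X) :
    ∃ T : Finset (Hypothesis X), candidates V A Su = T ∧ T.card ≤ (n + 1) ^ w := by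
  classical
  -- The surviving labellings form a class on the index set `Fin n`, to which Sauer-Shelah is
  -- applied.
  set Y : Set (Hypothesis (Fin n)) :=
    {y | empAdvRisk V (labelled Su y) (A n (labelled Su y)) = 0} with hY
  have hrob : ∀ y ∈ Y, ∀ i, ∀ z ∈ V (Su i), A n (labelled Su y) z = y i := fun y hy =>
    empAdvRisk_eq_zero_iff.1 hy
  obtain ⟨T, hTY, hTc, hT⟩ := exists_finset_representatives (H := Y) (v := w) (fun K hK => by
    -- If two indices of a shattered `K` shared a sample point, some surviving labelling would give
    -- that point two labels. So `Su` maps `K` to a robustly shattered set of equal size.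
    have hinj : Set.InjOn Su K := by
      intro i hi j hj hij
      by_contra hne
      obtain ⟨y, hy, hyK⟩ := hK fun k => decide (k = i)
      have h1 := hrob y hy i (Su i) (hV _)
      have h2 := hrob y hy j (Su j) (hV _)
      rw [hyK i hi] at h1
      rw [hyK j hj, ← hij, h1] at h2
      simp [Ne.symm hne] at h2
    rw [← Finset.card_image_of_injOn hinj]
    refine card_le_of_robustVCDim_le hw fun y => ?_
    obtain ⟨y', hy', hyK⟩ := hK (y ∘ Su)
    refine ⟨A n (labelled Su y'), (hA n _).1, fun x hx z hz => ?_⟩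
    obtain ⟨i, hi, rfl⟩ := Finset.mem_image.1 hx
    rw [hrob y' hy' i z hz, hyK i hi, Function.comp]) Finset.univ
  refine ⟨T.image fun y => A n (labelled Su y), ?_, Finset.card_image_le.trans (by simpa using hTc)⟩
  ext h
  simp only [candidates, Set.mem_ofPred_eq, Finset.coe_image, Set.mem_image, Finset.mem_coe]
  constructor
  · rintro ⟨y, rfl, hy⟩
    obtain ⟨t, ht, hyt⟩ := hT y hy
    have : y = t := funext fun i => hyt i (Finset.mem_univ i)
    exact ⟨t, ht, by rw [this]⟩
  · rintro ⟨y, hy, rfl⟩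
    exact ⟨y, rfl, hTY hy⟩

end Combinatorics

/-! ### Covering and local cardinality of the grid -/

section Grid

/-- The triangle inequality along coordinate vectors works for every `p`, including `∞`. Its factor
`d` dictates the side length `2ρ/d`. -/
theorem norm_le_card_mul_of_forall_abs_le {p : ℝ≥0∞} [Fact (1 ≤ p)] {d : ℕ} {x : Space p d} {b : ℝ}
    (hx : ∀ i, |x i| ≤ b) : ‖x‖ ≤ d * b := by
  have hsum : x = ∑ i, (PiLp.single p i (x i) : Space p d) := by
    ext j
    simp
  calc ‖x‖ ≤ ∑ i : Fin d, ‖(PiLp.single p i (x i) : Space p d)‖ := by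
        conv_lhs => rw [hsum]
        exact norm_sum_le _ _
    _ ≤ ∑ _i : Fin d, b := Finset.sum_le_sum fun i _ => by
        rw [PiLp.norm_single]
        exact hx i
    _ = d * b := by simp

theorem isCoverOf_grid (p : ℝ≥0∞) [Fact (1 ≤ p)] {d : ℕ} (hd : 1 ≤ d) {ρ : ℝ} (hρ : 0 < ρ) :
    IsCoverOf ρ (grid p d (2 * ρ / d)) := by
  intro x
  have hd' : (0 : ℝ) < d := by exact_mod_cast hd
  set s : ℝ := 2 * ρ / d with hs
  have hs0 : 0 < s := by positivity
  refine ⟨WithLp.toLp p fun i => (round (x i / s) : ℝ) * s, fun i => ⟨round (x i / s), rfl⟩, ?_⟩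
  rw [dist_eq_norm]
  calc _ ≤ d * (s / 2) := norm_le_card_mul_of_forall_abs_le fun i => by
        have h := abs_sub_round (x i / s)
        have h2 : x i - (round (x i / s) : ℝ) * s = (x i / s - round (x i / s)) * s := by
          field_simp
        simp only [PiLp.sub_apply]
        rw [h2, abs_mul, abs_of_pos hs0]
        nlinarith
    _ = ρ := by rw [hs]; field_simp

theorem grid_inter_closedBall_card_le (p : ℝ≥0∞) [Fact (1 ≤ p)] (d : ℕ) {s R : ℝ} (hs : 0 < s)
    (hR : 0 ≤ R) (x : Space p d) :
    (grid p d s ∩ Metric.closedBall x R).Finite ∧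
      ((grid p d s ∩ Metric.closedBall x R).ncard : ℝ) ≤ (2 * R / s + 1) ^ d := by
  classical
  set I : Fin d → Finset ℤ := fun i => Finset.Icc ⌈(x i - R) / s⌉ ⌊(x i + R) / s⌋ with hI
  set f : (Fin d → ℤ) → Space p d := fun k => WithLp.toLp p fun i => (k i : ℝ) * s with hf
  have hsub : grid p d s ∩ Metric.closedBall x R ⊆ ((Fintype.piFinset I).image f : Set _) := by
    rintro y ⟨hy, hyx⟩
    choose k hk using hy
    have hyi : ∀ i, |y i - x i| ≤ R := fun i =>
      (PiLp.norm_apply_le (y - x) i).trans (by rwa [← dist_eq_norm])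
    refine Finset.mem_coe.2 (Finset.mem_image.2 ⟨k, ?_, ?_⟩)
    · rw [Fintype.mem_piFinset]
      intro i
      have := abs_le.1 (hyi i)
      rw [hk i] at this
      rw [Finset.mem_Icc, Int.ceil_le, Int.le_floor, div_le_iff₀ hs, le_div_iff₀ hs]
      constructor <;> linarith
    · ext i
      simp [hf, hk i]
  have hcard : ∀ i, ((I i).card : ℝ) ≤ 2 * R / s + 1 := by
    intro i
    rw [hI, Int.card_Icc]
    have h1 := Int.floor_le ((x i + R) / s)
    have h2 := Int.le_ceil ((x i - R) / s)
    have h3 : (x i + R) / s - (x i - R) / s = 2 * R / s := by ring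
    have h4 : 0 ≤ 2 * R / s := by positivity
    rw [← Int.cast_natCast, Int.toNat_eq_max, Int.cast_max]
    refine max_le ?_ (by push_cast; linarith)
    push_cast
    linarith
  refine ⟨(Finset.finite_toSet _).subset hsub, ?_⟩
  calc ((grid p d s ∩ Metric.closedBall x R).ncard : ℝ)
      ≤ ((Fintype.piFinset I).card : ℝ) := by
        have h1 := Set.ncard_le_ncard hsub (Finset.finite_toSet _)
        rw [Set.ncard_coe_finset] at h1
        exact_mod_cast h1.trans Finset.card_image_le
    _ = ∏ i, ((I i).card : ℝ) := by rw [Fintype.card_piFinset]; push_cast; rfl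
    _ ≤ ∏ _i : Fin d, (2 * R / s + 1) :=
        Finset.prod_le_prod (fun _ _ => by positivity) fun i _ => hcard i
    _ = _ := by simp

end Grid

/-! ### ε-nets for disagreement regions -/

section Disagreement

variable {X : Type*}

/-- The points at which `h` and `h₀` differ on some perturbation. -/
def disagreement (U : PerturbationType X) (h₀ h : Hypothesis X) : Set X :=
  {x | ∃ z ∈ U x, h z ≠ h₀ z}

/-- The hypotheses only select which `z ∈ C` enter a countable union of sets `{x | z ∈ U x}`, so
they need not be measurable. -/
theorem measurableSet_disagreement [MeasurableSpace X] {U : PerturbationType X} {C : Set X}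
    (hC : C.Countable) (hUC : ∀ x, U x ⊆ C) (hUm : ∀ z, MeasurableSet {x | z ∈ U x})
    (h₀ h : Hypothesis X) : MeasurableSet (disagreement U h₀ h) := by
  have : disagreement U h₀ h = ⋃ z ∈ {z ∈ C | h z ≠ h₀ z}, {x | z ∈ U x} := by
    ext x
    simp only [disagreement, Set.mem_ofPred_eq, Set.mem_iUnion, exists_prop]
    exact ⟨fun ⟨z, hz, hne⟩ => ⟨z, ⟨hUC x hz, hne⟩, hz⟩, fun ⟨z, ⟨_, hne⟩, hz⟩ => ⟨z, hz, hne⟩⟩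
  rw [this]
  exact MeasurableSet.biUnion (hC.mono fun z hz => hz.1) fun z _ => hUm z

theorem measurableSet_lossSet [MeasurableSpace X] {U : PerturbationType X} {C : Set X}
    (hC : C.Countable) (hUC : ∀ x, U x ⊆ C) (hUm : ∀ z, MeasurableSet {x | z ∈ U x})
    (h : Hypothesis X) : MeasurableSet (lossSet U h) := by
  have : lossSet U h = ⋃ z ∈ C, {x | z ∈ U x} ×ˢ {y | h z ≠ y} := by
    ext q
    simp only [mem_lossSet_iff, Set.mem_iUnion, exists_prop, Set.mem_prod, Set.mem_ofPred_eq]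
    exact ⟨fun ⟨z, hz, hne⟩ => ⟨z, hUC _ hz, hz, hne⟩, fun ⟨z, _, hz, hne⟩ => ⟨z, hz, hne⟩⟩
  rw [this]
  exact MeasurableSet.biUnion hC fun z _ => (hUm z).prod (Set.toFinite _).measurableSet

variable [MeasurableSpace X] (μ : Measure X) [IsProbabilityMeasure μ] {U : PerturbationType X}
  {H : Set (Hypothesis X)} {v N n : ℕ}

/-- Truncation to a finite `F` leaves finitely many distinct disagreement regions. The bound does
not depend on `F`, because a double sample has at most `2nN` perturbations. -/
theorem measure_exists_consistent_finite_mul_le (F : Finset X)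
    (hUm : ∀ z, MeasurableSet {x | z ∈ U x}) (hUfin : ∀ x, (U x).Finite)
    (hUN : ∀ x, (U x).ncard ≤ N) (hv : ∀ K : Finset X, Shatters H K → K.card ≤ v)
    (h₀ : Hypothesis X) (e : ℝ≥0∞) :
    (1 + e) ^ n * (Measure.pi fun _ : Fin n => μ)
        {S | ∃ h ∈ H, e ≤ μ (disagreement (fun x => U x ∩ F) h₀ h) ∧
          ∀ k, S k ∉ disagreement (fun x => U x ∩ F) h₀ h}
      ≤ ((2 * n * N + 1) ^ v : ℕ) := by
  classical
  obtain ⟨T₀, hT₀H, -, hT₀⟩ := exists_finset_representatives hv F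
  set D : Hypothesis X → Set X := disagreement (fun x => U x ∩ F) h₀ with hD
  have hDm : ∀ h, MeasurableSet (D h) := fun h => by
    refine measurableSet_disagreement F.countable_toSet (fun x => Set.inter_subset_right)
      (fun z => ?_) h₀ h
    by_cases hz : z ∈ F
    · simpa [hz] using hUm z
    · simp [hz]
  refine le_trans ?_ (measure_exists_missed_mul_le μ T₀ D hDm (n := n) (e := e) fun z => ?_)
  · refine mul_le_mul' le_rfl (measure_mono ?_)
    rintro S ⟨h, hh, hS⟩
    obtain ⟨t, ht, hht⟩ := hT₀ h hh
    have hDht : D h = D t := by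
      ext x
      simp only [hD, disagreement, Set.mem_ofPred_eq]
      refine exists_congr fun z => and_congr_right fun hz => ?_
      rw [hht z hz.2]
    rw [hDht] at hS
    exact ⟨t, ht, hS⟩
  · set F' : Finset X := Finset.univ.biUnion fun k : Fin n =>
      (hUfin (z k).1).toFinset ∪ (hUfin (z k).2).toFinset with hF'
    have hF'c : F'.card ≤ 2 * n * N := by
      refine (Finset.card_biUnion_le_card_mul _ _ (2 * N) fun k _ => ?_).trans (by simp; linarith)
      refine (Finset.card_union_le _ _).trans ?_
      rw [← Set.ncard_eq_toFinset_card _ (hUfin _), ← Set.ncard_eq_toFinset_card _ (hUfin _)]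
      linarith [hUN (z k).1, hUN (z k).2]
    obtain ⟨T, -, hTc, hT⟩ := exists_finset_representatives hv F'
    refine ⟨T, by exact_mod_cast hTc.trans (by gcongr), fun h hh => ?_⟩
    obtain ⟨t, ht, hht⟩ := hT h (hT₀H hh)
    refine ⟨t, ht, fun k => ⟨?_, ?_⟩⟩ <;>
    · simp only [hD, disagreement, Set.mem_ofPred_eq]
      refine exists_congr fun y => and_congr_right fun hy => ?_
      rw [hht y (Finset.mem_biUnion.2 ⟨k, Finset.mem_univ k, by simp [hy.1]⟩)]

/-- Uniform convergence of the disagreement with a fixed hypothesis. No measurability of the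
hypotheses is needed, since the perturbations lie in a countable set. -/
theorem measure_exists_consistent_mul_le [Nonempty X] {C : Set X} (hC : C.Countable)
    (hUC : ∀ x, U x ⊆ C)
    (hUm : ∀ z, MeasurableSet {x | z ∈ U x}) (hUfin : ∀ x, (U x).Finite)
    (hUN : ∀ x, (U x).ncard ≤ N) (hv : ∀ K : Finset X, Shatters H K → K.card ≤ v)
    (h₀ : Hypothesis X) (e : ℝ≥0∞) :
    (1 + e) ^ n * (Measure.pi fun _ : Fin n => μ)
        {S | ∃ h ∈ H, e < μ (disagreement U h₀ h) ∧ ∀ k, S k ∉ disagreement U h₀ h}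
      ≤ ((2 * n * N + 1) ^ v : ℕ) := by
  classical
  obtain ⟨f, hf⟩ := Set.countable_iff_exists_subset_range.1 hC
  set F : ℕ → Finset X := fun k => (Finset.range k).image f with hF
  have hFmono : Monotone F := fun a b hab =>
    Finset.image_subset_image (Finset.range_mono hab)
  set D : ℕ → Hypothesis X → Set X := fun k => disagreement (fun x => U x ∩ F k) h₀ with hD
  have hDmono : ∀ h, Monotone fun k => D k h := fun h a b hab x ⟨z, hz, hne⟩ =>
    ⟨z, ⟨hz.1, hFmono hab hz.2⟩, hne⟩
  have hDU : ∀ h, disagreement U h₀ h = ⋃ k, D k h := by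
    intro h
    ext x
    simp only [hD, disagreement, Set.mem_iUnion, Set.mem_ofPred_eq]
    constructor
    · rintro ⟨z, hz, hne⟩
      obtain ⟨k, rfl⟩ := hf (hUC x hz)
      exact ⟨k + 1, f k, ⟨hz, Finset.mem_coe.2 (Finset.mem_image_of_mem f (by simp))⟩, hne⟩
    · rintro ⟨k, z, hz, hne⟩
      exact ⟨z, hz.1, hne⟩
  -- Only the measure condition is truncated; avoidance refers to the full region. This makes `E`
  -- increasing, and the strict inequality is reached at a finite stage. Continuity from below holds
  -- for outer measure too.
  set E : ℕ → Set (Fin n → X) := fun k =>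
    {S | ∃ h ∈ H, e < μ (D k h) ∧ ∀ i, S i ∉ disagreement U h₀ h} with hE
  have hEmono : Monotone E := fun a b hab S ⟨h, hh, he, hS⟩ =>
    ⟨h, hh, he.trans_le (measure_mono (hDmono h hab)), hS⟩
  have hEU : {S : Fin n → X | ∃ h ∈ H, e < μ (disagreement U h₀ h) ∧
      ∀ k, S k ∉ disagreement U h₀ h} ⊆ ⋃ k, E k := by
    rintro S ⟨h, hh, he, hS⟩
    rw [hDU, (hDmono h).measure_iUnion, lt_iSup_iff] at he
    obtain ⟨k, hk⟩ := he
    exact Set.mem_iUnion.2 ⟨k, h, hh, hk, hS⟩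
  refine (mul_le_mul' le_rfl (measure_mono hEU)).trans ?_
  rw [hEmono.measure_iUnion, ENNReal.mul_iSup]
  refine iSup_le fun k => le_trans (mul_le_mul' le_rfl (measure_mono ?_))
    (measure_exists_consistent_finite_mul_le μ (F k) hUm hUfin hUN hv h₀ e)
  rintro S ⟨h, hh, he, hS⟩
  refine ⟨h, hh, he.le, fun i hi => hS i ?_⟩
  rw [hDU]
  exact Set.mem_iUnion.2 ⟨k, hi⟩

end Disagreement

/-! ### The unlabelled and the labelled stage of the learner -/

section Learner

variable {X : Type*}

/-- Needed for `v = 0`: with `δ` near one, the prescribed `n` may be too small for the ε-net bound,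
but the class has at most one member. -/
theorem eq_of_mem_of_vcDim_eq_zero {H : Set (Hypothesis X)}
    (hv : ∀ K : Finset X, Shatters H K → K.card ≤ 0) {h h' : Hypothesis X} (hh : h ∈ H)
    (hh' : h' ∈ H) : h = h' := by
  by_contra hne
  obtain ⟨x, hx⟩ := Function.ne_iff.1 hne
  have := hv {x} fun y => by
    by_cases hy : h x = y x
    · exact ⟨h, hh, by simpa using hy⟩
    · refine ⟨h', hh', ?_⟩
      intro x' hx'
      rw [Finset.mem_singleton.1 hx']
      exact (Bool.eq_not_of_ne hx.symm).trans (Bool.eq_not_of_ne (Ne.symm hy)).symm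
  simp at this

theorem measurableSet_mem_discretized [MeasurableSpace X] [MetricSpace X] [OpensMeasurableSpace X]
    (C : Set X) (R : ℝ) (z : X) : MeasurableSet {x | z ∈ discretized (ballType R) C x} := by
  by_cases hz : z ∈ C
  · have : {x | z ∈ discretized (ballType R) C x} = Metric.closedBall z R := by
      ext x
      simp [discretized, ballType, hz, dist_comm]
    rw [this]
    exact Metric.isClosed_closedBall.measurableSet
  · simp [discretized, hz]

/-- The tolerance is spent here: the cover point nearest to a perturbation within `r` of `x` lies
within `r + ρ ≤ R` of `x`, hence in `C ∩ V x`, and `h` errs there. -/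
theorem lossSet_subset_of_isNNDiscretization [MetricSpace X] {C : Set X} {r ρ R : ℝ}
    (hcov : IsCoverOf ρ C) (hR : r + ρ ≤ R) {h g : Hypothesis X} (hg : IsNNDiscretization C h g) :
    lossSet (ballType r) g ⊆ lossSet (discretized (ballType R) C) h := by
  intro q hq
  obtain ⟨z, hz, hne⟩ := mem_lossSet_iff.1 hq
  obtain ⟨c, hc, hmin, hgz⟩ := hg z
  obtain ⟨c', hc', hd⟩ := hcov z
  refine mem_lossSet_iff.2 ⟨c, ⟨hc, ?_⟩, by rwa [← hgz]⟩
  have h1 := hmin c' hc'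
  have h2 : dist z q.1 ≤ r := hz
  have h3 := dist_triangle_left c q.1 z
  change dist c q.1 ≤ R
  linarith

theorem lossSet_subset_union_disagreement (U : PerturbationType X) (h₀ h : Hypothesis X) :
    lossSet U h ⊆ lossSet U h₀ ∪ Prod.fst ⁻¹' disagreement U h₀ h := by
  intro q hq
  obtain ⟨z, hz, hne⟩ := mem_lossSet_iff.1 hq
  by_cases hz' : h z = h₀ z
  · exact Or.inl (mem_lossSet_iff.2 ⟨z, hz, by rwa [← hz']⟩)
  · exact Or.inr ⟨z, hz, hz'⟩

/-- The points around which `h` is not constant are contained in a measurable set of measure at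
most the adversarial risk of `h`. -/
theorem exists_measurableSet_not_robust [MeasurableSpace X] {V : PerturbationType X}
    (hV : ∀ x, x ∈ V x) (P : Measure (X × Bool)) (h : Hypothesis X) :
    ∃ M : Set X, MeasurableSet M ∧ P.fst M ≤ advRisk V P h ∧
      ∀ x ∉ M, ∀ z ∈ V x, h z = h x := by
  -- A point with a non-constant neighbourhood incurs loss under both labels, so both its labelled
  -- copies lie in `T`.
  set T := toMeasurable P (lossSet V h) with hT
  have hTm : MeasurableSet T := measurableSet_toMeasurable _ _
  have hMm : ∀ b : Bool, MeasurableSet {x | (x, b) ∈ T} := fun b => measurable_prodMk_right hTm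
  refine ⟨{x | (x, true) ∈ T} ∩ {x | (x, false) ∈ T}, (hMm true).inter (hMm false), ?_, ?_⟩
  · rw [Measure.fst_apply ((hMm true).inter (hMm false)), advRisk,
      ← measure_toMeasurable (lossSet V h)]
    apply measure_mono
    rintro ⟨x, b⟩ ⟨h1, h2⟩
    cases b
    · exact h2
    · exact h1
  · intro x hx z hz
    by_contra hne
    refine hx ?_
    have hb : ∀ b : Bool, (x, b) ∈ T := fun b => by
      apply subset_toMeasurable
      by_cases hb : h x = b
      · exact mem_lossSet_iff.2 ⟨z, hz, by rwa [← hb]⟩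
      · exact mem_lossSet_iff.2 ⟨x, hV x, hb⟩
    exact ⟨hb true, hb false⟩

theorem measure_pi_exists_mem_le [MeasurableSpace X] (μ : Measure X) [IsProbabilityMeasure μ]
    {M : Set X} (hM : MeasurableSet M) (n : ℕ) :
    (Measure.pi fun _ : Fin n => μ) {S | ∃ i, S i ∈ M} ≤ n * μ M := by
  have : {S : Fin n → X | ∃ i, S i ∈ M} = ⋃ i, (Function.eval i) ⁻¹' M := by
    ext S; simp
  rw [this]
  refine (measure_iUnion_fintype_le _ _).trans ?_
  simp_rw [fun i => (measurePreserving_eval (fun _ : Fin n => μ) i).measure_preimage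
    hM.nullMeasurableSet]
  simp

theorem measure_labelled_failure_le [MeasurableSpace X] [MetricSpace X] [OpensMeasurableSpace X]
    {C : Set X} (hC : C.Countable) {r ρ R : ℝ} (hR0 : 0 ≤ R) (hcov : IsCoverOf ρ C)
    (hR : r + ρ ≤ R) {H : Set (Hypothesis X)} {A : (n : ℕ) → Sample X n → Hypothesis X}
    (hA : IsRERMOracle (ballType R) H A)
    {L : (m n : ℕ) → Sample X m → (Fin n → X) → Hypothesis X}
    (hL : ImplementsSSL (ballType R) C A L) {w : ℕ} (hw : robustVCDim (ballType R) H ≤ w)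
    (P : Measure (X × Bool)) [IsProbabilityMeasure P] {ε δ : ℝ} (hε0 : 0 < ε) (hε1 : ε < 1)
    {m n : ℕ} (hm0 : m ≠ 0) (hm : w = 0 ∨ ((n : ℝ) + 1) ^ w * Real.exp (-(m * ε ^ 2 / 16)) ≤ δ)
    (Su : Fin n → X) {h' : Hypothesis X} (hh' : h' ∈ candidates (ballType R) A Su)
    (hgood : P (lossSet (discretized (ballType R) C) h') ≤ ENNReal.ofReal (ε / 2)) :
    (Measure.pi fun _ : Fin m => P)
        {Sl | ENNReal.ofReal ε < advRisk (ballType r) P (L m n Sl Su)} ≤ ENNReal.ofReal δ := by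
  classical
  set W := discretized (ballType R) C with hW
  have hWm : ∀ h, MeasurableSet (lossSet W h) := by
    refine measurableSet_lossSet hC (fun x => Set.inter_subset_left)
      (measurableSet_mem_discretized C R)
  obtain ⟨T, hT, hTc⟩ := exists_finset_candidates (V := ballType R) (fun x => Metric.mem_closedBall_self hR0) hA hw Su
  have key : ∀ Sl : Sample X m, ENNReal.ofReal ε < advRisk (ballType r) P (L m n Sl Su) →
      ∃ h ∈ T, ENNReal.ofReal ε < P (lossSet W h) ∧
        ∑ i, (lossSet W h).indicator (1 : X × Bool → ℝ≥0∞) (Sl i)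
          ≤ ∑ i, (lossSet W h').indicator (1 : X × Bool → ℝ≥0∞) (Sl i) := by
    intro Sl hSl
    obtain ⟨h, ⟨hhc, hmin⟩, hg⟩ := hL m n Sl Su ⟨h', hh'⟩
    refine ⟨h, by rw [hT] at hhc; exact hhc, hSl.trans_le (measure_mono
      (lossSet_subset_of_isNNDiscretization hcov hR hg)),
      sum_indicator_le_of_empAdvRisk_le hm0 (hmin h' hh')⟩
  -- For `w = 0` there is a single candidate, which must be `h'`, and no concentration is needed.
  rcases hm with rfl | hm
  · refine (measure_mono_null (t := ∅) (fun Sl hSl => ?_) measure_empty).trans_le zero_le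
    obtain ⟨h, hh, hbad, -⟩ := key Sl hSl
    have hh'T : h' ∈ T := by rw [hT] at hh'; exact hh'
    have : h = h' := Finset.card_le_one.1 (by simpa using hTc) h hh h' hh'T
    rw [this] at hbad
    exact absurd (hbad.trans_le hgood) (not_lt.2 (ENNReal.ofReal_le_ofReal (by linarith)))
  · calc _ ≤ (Measure.pi fun _ : Fin m => P)
          (⋃ h ∈ T.filter fun h => ENNReal.ofReal ε < P (lossSet W h),
            {Sl | ∑ i, (lossSet W h).indicator (1 : X × Bool → ℝ≥0∞) (Sl i)
              ≤ ∑ i, (lossSet W h').indicator (1 : X × Bool → ℝ≥0∞) (Sl i)}) := by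
          refine measure_mono fun Sl hSl => ?_
          obtain ⟨h, hh, hbad, hle⟩ := key Sl hSl
          exact Set.mem_biUnion (Finset.mem_filter.2 ⟨hh, hbad⟩) hle
      _ ≤ ∑ h ∈ T.filter fun h => ENNReal.ofReal ε < P (lossSet W h),
            ENNReal.ofReal (Real.exp (-(m * ε ^ 2 / 16))) := by
          refine (measure_biUnion_finset_le _ _).trans (Finset.sum_le_sum fun h hh => ?_)
          exact measure_sum_indicator_le_le P (hWm h) (hWm h') hε0 hε1 hgood
            (Finset.mem_filter.1 hh).2.le m
      _ ≤ ((n + 1) ^ w : ℕ) * ENNReal.ofReal (Real.exp (-(m * ε ^ 2 / 16))) := by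
          rw [Finset.sum_const, nsmul_eq_mul]
          gcongr
          exact (Finset.card_filter_le _ _).trans hTc
      _ = ENNReal.ofReal (((n : ℝ) + 1) ^ w * Real.exp (-(m * ε ^ 2 / 16))) := by
          rw [ENNReal.ofReal_mul (by positivity), ← ENNReal.ofReal_natCast]
          push_cast
          rfl
      _ ≤ _ := ENNReal.ofReal_le_ofReal hm

theorem exists_unlabelled_exceptional_set [MeasurableSpace X] [MetricSpace X]
    [OpensMeasurableSpace X] {C : Set X} (hC : C.Countable) {R : ℝ} (hR0 : 0 ≤ R) {N v : ℕ}
    (hfin : ∀ x, (discretized (ballType R) C x).Finite)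
    (hN : ∀ x, (discretized (ballType R) C x).ncard ≤ N)
    {H : Set (Hypothesis X)} (hv : vcDim H ≤ v) {A : (n : ℕ) → Sample X n → Hypothesis X}
    (hA : IsRERMOracle (ballType R) H A)
    (P : Measure (X × Bool)) [IsProbabilityMeasure P] (hP : approxError (ballType R) P H = 0)
    {ε δ : ℝ} (hε0 : 0 < ε) (hδ0 : 0 < δ) {n : ℕ}
    (hn : v = 0 ∨ (2 * (n : ℝ) * N + 1) ^ v ≤ δ / 4 * (1 + ε / 4) ^ n) :
    ∃ B : Set (Fin n → X), MeasurableSet B ∧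
      (Measure.pi fun _ : Fin n => P.fst) B ≤ ENNReal.ofReal (δ / 2) ∧
      ∀ Su ∉ B, ∃ h' ∈ candidates (ballType R) A Su,
        P (lossSet (discretized (ballType R) C) h') ≤ ENNReal.ofReal (ε / 2) := by
  classical
  set μ := Measure.pi fun _ : Fin n => P.fst with hμ
  have : Nonempty X := (nonempty_of_isProbabilityMeasure P).map Prod.fst
  set W := discretized (ballType R) C with hW
  have hWm : ∀ z, MeasurableSet {x | z ∈ W x} := measurableSet_mem_discretized C R
  -- The infimum need not be attained, so `h₀` is chosen after `n`: `ε / 4` bounds its own risk, the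
  -- other term pays for a union bound over `n` points, and `n + 1` covers `n = 0`.
  set η : ℝ := min (ε / 4) (δ / (4 * (n + 1))) with hη
  have hη0 : 0 < η := by rw [hη]; positivity
  obtain ⟨h₀, hh₀, hrisk⟩ : ∃ h ∈ H, advRisk (ballType R) P h < ENNReal.ofReal η := by
    have : approxError (ballType R) P H < ENNReal.ofReal η := by
      rw [hP]; exact ENNReal.ofReal_pos.2 hη0
    simpa [approxError, iInf_lt_iff] using this
  have hVx : ∀ x : X, x ∈ ballType R x := fun x => Metric.mem_closedBall_self hR0
  obtain ⟨M, hMm, hPM, hM⟩ := exists_measurableSet_not_robust hVx P h₀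
  set B₁ : Set (Fin n → X) := {S | ∃ i, S i ∈ M} with hB₁
  set B₂ : Set (Fin n → X) := {S | ∃ h ∈ H, ENNReal.ofReal (ε / 4) < P.fst (disagreement W h₀ h) ∧
    ∀ k, S k ∉ disagreement W h₀ h} with hB₂
  have hv' : ∀ K : Finset X, Shatters H K → K.card ≤ v := fun K hK => card_le_of_vcDim_le hv hK
  have hμ₁ : μ B₁ ≤ ENNReal.ofReal (δ / 4) := by
    refine (measure_pi_exists_mem_le P.fst hMm n).trans ?_
    calc (n : ℝ≥0∞) * P.fst M ≤ n * ENNReal.ofReal η := by gcongr; exact hPM.trans hrisk.le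
      _ = ENNReal.ofReal (n * η) := by
        rw [ENNReal.ofReal_mul (by positivity), ENNReal.ofReal_natCast]
      _ ≤ _ := by
        apply ENNReal.ofReal_le_ofReal
        calc (n : ℝ) * η ≤ (n + 1) * (δ / (4 * (n + 1))) := by
              gcongr
              · linarith
              · exact min_le_right _ _
          _ = δ / 4 := by field_simp
  have hμ₂ : μ B₂ ≤ ENNReal.ofReal (δ / 4) := by
    rcases hn with rfl | hn
    · refine (measure_mono_null (t := ∅) ?_ measure_empty).trans_le zero_le
      rintro S ⟨h, hh, he, -⟩
      rw [eq_of_mem_of_vcDim_eq_zero hv' hh hh₀] at he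
      simp [disagreement] at he
    · have hmul := (measure_exists_consistent_mul_le P.fst (n := n) hC
        (fun x => Set.inter_subset_left) hWm hfin hN hv' h₀ (ENNReal.ofReal (ε / 4))).trans
        (b := _) (c := ENNReal.ofReal (δ / 4 * (1 + ε / 4) ^ n)) (by
          rw [← ENNReal.ofReal_natCast]
          apply ENNReal.ofReal_le_ofReal
          push_cast
          exact hn)
      rw [mul_comm (δ / 4), ENNReal.ofReal_mul (by positivity), ENNReal.ofReal_pow (by positivity),
        ENNReal.ofReal_add (by norm_num) (by positivity), ENNReal.ofReal_one] at hmul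
      exact (ENNReal.mul_le_mul_iff_right (by simp) (by finiteness)).1 hmul
  -- `B₂` is a union over all of `H` and may fail to be measurable, hence the measurable hull.
  refine ⟨toMeasurable μ (B₁ ∪ B₂), measurableSet_toMeasurable _ _, ?_, fun Su hSu => ?_⟩
  · rw [measure_toMeasurable]
    refine (measure_union_le _ _).trans ((add_le_add hμ₁ hμ₂).trans_eq ?_)
    rw [← ENNReal.ofReal_add (by positivity) (by positivity)]
    congr 1
    ring
  · have hSu' : Su ∉ B₁ ∪ B₂ := fun h => hSu (subset_toMeasurable _ _ h)
    have hrob : ∀ i, ∀ z ∈ ballType R (Su i), h₀ z = h₀ (Su i) := fun i =>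
      hM _ fun hi => hSu' (Or.inl ⟨i, hi⟩)
    set S := labelled Su fun i => h₀ (Su i) with hS
    have hzero : empAdvRisk (ballType R) S (A n S) = 0 := by
      have h1 := (hA n S).2 h₀ hh₀
      rw [empAdvRisk_eq_zero_iff (S := S) (h := h₀).2 hrob] at h1
      exact le_antisymm h1 zero_le
    refine ⟨A n S, ⟨_, rfl, hzero⟩, ?_⟩
    have hdis : P.fst (disagreement W h₀ (A n S)) ≤ ENNReal.ofReal (ε / 4) := by
      by_contra! hlt
      refine hSu' (Or.inr ⟨A n S, (hA n S).1, hlt, ?_⟩)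
      rintro k ⟨z, hz, hne⟩
      refine hne ((empAdvRisk_eq_zero_iff.1 hzero k z hz.2).trans (hrob k z hz.2).symm)
    have hdm : MeasurableSet (disagreement W h₀ (A n S)) :=
      measurableSet_disagreement hC (fun x => Set.inter_subset_left) hWm _ _
    rw [Measure.fst_apply hdm] at hdis
    refine (measure_mono (lossSet_subset_union_disagreement W h₀ _)).trans
      ((measure_union_le _ _).trans ?_)
    have hloss : P (lossSet W h₀) ≤ ENNReal.ofReal (ε / 4) := by
      refine (measure_mono ?_).trans (hrisk.le.trans
        (ENNReal.ofReal_le_ofReal (min_le_left _ _)))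
      intro q hq
      obtain ⟨z, hz, hne⟩ := mem_lossSet_iff.1 hq
      exact mem_lossSet_iff.2 ⟨z, hz.2, hne⟩
    refine (add_le_add hloss hdis).trans_eq ?_
    rw [← ENNReal.ofReal_add (by positivity) (by positivity)]
    congr 1
    ring

end Learner

/-! ### From the stated rates to the required inequalities -/

section SampleComplexity

theorem half_lt_log_two_add {x : ℝ} (hx : 0 ≤ x) : 1 / 2 < Real.log (2 + x) := by
  have h1 := Real.log_two_gt_d9
  have h2 : Real.log 2 ≤ Real.log (2 + x) := Real.log_le_log (by norm_num) (by linarith)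
  linarith

/-- Since `log (2 + 1/γ) > 1/2`, the rate controls `v * d`. This lets its logarithm absorb factors
of `log d` and `log v`. -/
theorem le_two_mul_unlabelledRate_mul {v d : ℕ} (hd : 1 ≤ d) {γ ε δ : ℝ}
    (hγ : 0 < γ) (hε0 : 0 < ε) (hδ0 : 0 < δ) (hδ1 : δ < 1) :
    (v : ℝ) * d ≤ 2 * (unlabelledRate v d γ ε δ * ε) := by
  have hd' : (1 : ℝ) ≤ d := by exact_mod_cast hd
  have hlam := half_lt_log_two_add (x := 1 / γ) (by positivity)
  have hlogd : 0 ≤ Real.log d := Real.log_nonneg hd'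
  have hlogδ : 0 < Real.log (1 / δ) := Real.log_pos (by rw [lt_div_iff₀ hδ0]; linarith)
  rw [unlabelledRate, div_mul_cancel₀ _ hε0.ne']
  have hv : (0 : ℝ) ≤ v := by positivity
  have h1 := mul_nonneg hv hlogd
  have h2 : 0 ≤ (v : ℝ) * d * (Real.log (2 + 1 / γ) - 1 / 2) :=
    mul_nonneg (by positivity) (by linarith)
  linarith

theorem two_le_of_unlabelled_sample_size {v d : ℕ} (hv : v ≠ 0) (hd : 1 ≤ d) {c γ ε δ : ℝ}
    (hc : 448 ≤ c) (hγ : 0 < γ) (hε0 : 0 < ε) (hε1 : ε < 1) (hδ0 : 0 < δ) (hδ1 : δ < 1) {n : ℕ}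
    (hn : c * polylog 1 (unlabelledRate v d γ ε δ) ≤ n) : 2 ≤ n := by
  have h1 := le_two_mul_unlabelledRate_mul (v := v) hd hγ hε0 hδ0 hδ1
  set f := unlabelledRate v d γ ε δ
  have hv' : (1 : ℝ) ≤ v := by exact_mod_cast Nat.one_le_iff_ne_zero.2 hv
  have hd' : (1 : ℝ) ≤ d := by exact_mod_cast hd
  have h2 : 1 ≤ (v : ℝ) * d := one_le_mul_of_one_le_of_one_le hv' hd'
  have hf0 : 0 < f := by
    by_contra! h
    nlinarith
  have hf : 1 / 2 ≤ f := by nlinarith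
  have hl := half_lt_log_two_add hf0.le
  rw [polylog, pow_one] at hn
  have h3 : 1 / 4 ≤ f * Real.log (2 + f) := by nlinarith
  have h4 : (2 : ℝ) ≤ n := by nlinarith
  exact_mod_cast h4

theorem pow_le_of_log_terms_le {v n N : ℕ} {Q ε δ : ℝ} (hv' : (1 : ℝ) ≤ v) (hn0 : (1 : ℝ) ≤ n)
    (hQ1 : 1 ≤ Q) (hNQ : (N : ℝ) ≤ Q) (hε0 : 0 < ε) (hε1 : ε < 1) (hδ0 : 0 < δ)
    (hlog : v * Real.log (16 * v / ε) + v * Real.log 3 + v * Real.log Q + Real.log 4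
      + Real.log (1 / δ) ≤ n * ε / 16) :
    (2 * (n : ℝ) * N + 1) ^ v ≤ δ / 4 * (1 + ε / 4) ^ n := by
  have hleft : 2 * (n : ℝ) * N + 1 ≤ 3 * n * Q := by
    have h1 : 2 * (n : ℝ) * N ≤ 2 * n * Q := by gcongr
    have h2 : 1 ≤ n * Q := one_le_mul_of_one_le_of_one_le hn0 hQ1
    linarith
  have hlogleft : Real.log (2 * (n : ℝ) * N + 1) ≤ Real.log 3 + Real.log n + Real.log Q := by
    refine (Real.log_le_log (by positivity) hleft).trans_eq ?_
    rw [Real.log_mul (by positivity) (by positivity), Real.log_mul (by positivity) (by positivity)]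
  -- The right side of the goal supplies `n * ε / 8`. Applying `log t ≤ t - 1` at `t = nε/(16v)`
  -- spends half of it on removing `log n`; the other half is `hlog`.
  have hlogn : v * Real.log n ≤ n * ε / 16 + v * Real.log (16 * v / ε) := by
    have hb : 0 < 16 * v / ε := by positivity
    have h1 := Real.log_le_sub_one_of_pos (x := n / (16 * v / ε)) (by positivity)
    rw [Real.log_div (by positivity) hb.ne'] at h1
    have h2 : v * (n / (16 * v / ε)) = n * ε / 16 := by field_simp
    have h3 := mul_le_mul_of_nonneg_left h1 (by linarith : (0 : ℝ) ≤ v)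
    linarith
  have hright : ε / 8 ≤ Real.log (1 + ε / 4) := by
    refine le_trans ?_ (Real.one_sub_inv_le_log_of_pos (by positivity))
    have : (1 + ε / 4)⁻¹ ≤ 1 - ε / 8 := by
      rw [inv_le_iff_one_le_mul₀ (by positivity)]
      nlinarith
    linarith
  have hnright := mul_le_mul_of_nonneg_left hright (by linarith : (0 : ℝ) ≤ n)
  rw [← Real.log_le_log_iff (by positivity) (by positivity), Real.log_pow,
    Real.log_mul (by positivity) (by positivity), Real.log_pow,
    Real.log_div (by positivity) (by norm_num)]
  rw [one_div δ, Real.log_inv] at hlog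
  have hmain := mul_le_mul_of_nonneg_left hlogleft (by linarith : (0 : ℝ) ≤ v)
  linarith

theorem unlabelled_sample_size {v d N : ℕ} (hv : v ≠ 0) (hd : 1 ≤ d) {K γ ε δ : ℝ} (hK : 1 ≤ K)
    (hγ : 0 < γ) (hNQ : (N : ℝ) ≤ (K * d * (1 + 1 / γ)) ^ d)
    (hε0 : 0 < ε) (hε1 : ε < 1) (hδ0 : 0 < δ) (hδ1 : δ < 1) {n : ℕ}
    (hn : (448 + 64 * Real.log K) * polylog 1 (unlabelledRate v d γ ε δ) ≤ n) :
    (2 * (n : ℝ) * N + 1) ^ v ≤ δ / 4 * (1 + ε / 4) ^ n := by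
  have hlogK : 0 ≤ Real.log K := Real.log_nonneg hK
  have hn2 := two_le_of_unlabelled_sample_size hv hd (by linarith) hγ hε0 hε1 hδ0 hδ1 hn
  have hn0 : (1 : ℝ) ≤ n := by exact_mod_cast (by omega : 1 ≤ n)
  have hvd := le_two_mul_unlabelledRate_mul (v := v) hd hγ hε0 hδ0 hδ1
  set f := unlabelledRate v d γ ε δ with hf
  have hv' : (1 : ℝ) ≤ v := by exact_mod_cast Nat.one_le_iff_ne_zero.2 hv
  have hd' : (1 : ℝ) ≤ d := by exact_mod_cast hd
  have hvv : (v : ℝ) ≤ v * d := le_mul_of_one_le_right (by linarith) hd'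
  have hdv : (d : ℝ) ≤ v * d := le_mul_of_one_le_left (by linarith) hv'
  have hfε : f * ε = v * (d * Real.log (2 + 1 / γ) + Real.log d) + Real.log (1 / δ) := by
    rw [hf, unlabelledRate, div_mul_cancel₀ _ hε0.ne']
  have hlogd : 0 ≤ Real.log d := Real.log_nonneg hd'
  have hlogδ : 0 < Real.log (1 / δ) := Real.log_pos (by rw [lt_div_iff₀ hδ0]; linarith)
  have hlam := half_lt_log_two_add (x := 1 / γ) (by positivity)
  have hf0 : 0 < f := by
    by_contra! h
    nlinarith
  set F := f * ε with hF
  have hFf : F ≤ f := by rw [hF]; nlinarith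
  set l := Real.log (2 + f) with hl
  have hl2 : Real.log 2 ≤ l := Real.log_le_log (by norm_num) (by linarith)
  have hlhalf : 1 / 2 < l := half_lt_log_two_add hf0.le
  have hlogf : Real.log f ≤ l := Real.log_le_log hf0 (by linarith)
  have hF0 : 0 < F := by positivity
  have hFl : 0 < F * l := by positivity
  have hFFl : F ≤ 2 * (F * l) := by nlinarith
  -- After division by 16 the budget is `28 + 4 log K` times `F * l`; the terms below use `26 + 4
  -- log K`.
  have hnε : (448 + 64 * Real.log K) * (F * l) ≤ n * ε := by
    rw [polylog, pow_one] at hn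
    calc _ = (448 + 64 * Real.log K) * (f * l) * ε := by rw [hF]; ring
      _ ≤ n * ε := by gcongr
  -- the terms of the logarithmic bound, each compared with `F * l`
  have hlog4 : Real.log 4 = 2 * Real.log 2 := by
    rw [show (4 : ℝ) = 2 ^ 2 by norm_num, Real.log_pow]; norm_num
  have hlog3 : Real.log 3 ≤ 2 * l := by
    have : Real.log 3 ≤ Real.log 4 := Real.log_le_log (by norm_num) (by norm_num)
    linarith
  have hvl : v * l ≤ 2 * (F * l) := by
    have := mul_le_mul_of_nonneg_right (hvv.trans hvd) (by linarith : 0 ≤ l)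
    linarith
  have hterm_b : v * Real.log (16 * v / ε) ≤ 12 * (F * l) := by
    have h1 : 16 * v / ε ≤ 2 ^ 5 * f := by
      rw [div_le_iff₀ hε0]
      calc 16 * (v : ℝ) ≤ 16 * (2 * F) := by linarith
        _ = 2 ^ 5 * f * ε := by rw [hF]; ring
    have h2 : Real.log (16 * v / ε) ≤ 6 * l := by
      refine (Real.log_le_log (by positivity) h1).trans ?_
      rw [Real.log_mul (by norm_num) hf0.ne', Real.log_pow]
      push_cast
      linarith
    have := mul_le_mul_of_nonneg_left h2 (by linarith : (0 : ℝ) ≤ v)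
    linarith
  have hterm_3 : v * Real.log 3 ≤ 4 * (F * l) := by
    have := mul_le_mul_of_nonneg_left hlog3 (by linarith : (0 : ℝ) ≤ v)
    linarith
  have hterm_4 : Real.log 4 ≤ 4 * (F * l) := by
    have : l ≤ v * l := le_mul_of_one_le_left (by linarith) hv'
    linarith
  -- The rate contains only `v * log d`. The extra factor `d` is affordable because `d ≤ 2 * f` puts
  -- `log d` inside the polylogarithm.
  have hterm_d : (v * d : ℝ) * Real.log d ≤ 4 * (F * l) := by
    have h1 : Real.log d ≤ 2 * l := by
      have : Real.log d ≤ Real.log (2 * f) := Real.log_le_log (by linarith) (by linarith)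
      rw [Real.log_mul (by norm_num) hf0.ne'] at this
      linarith
    have h2 := mul_le_mul hvd h1 hlogd (by positivity)
    linarith
  have hterm_K : (v * d : ℝ) * Real.log K ≤ 4 * Real.log K * (F * l) := by
    have h1 := mul_le_mul_of_nonneg_right hvd hlogK
    have h2 := mul_le_mul_of_nonneg_right hFFl hlogK
    linarith
  have hterm_lam : (v * d : ℝ) * Real.log (1 + 1 / γ) + Real.log (1 / δ) ≤ 2 * (F * l) := by
    have h1 : Real.log (1 + 1 / γ) ≤ Real.log (2 + 1 / γ) :=
      Real.log_le_log (by positivity) (by linarith)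
    have h2 := mul_le_mul_of_nonneg_left h1 (by positivity : (0 : ℝ) ≤ v * d)
    have h3 := mul_nonneg (by linarith : (0 : ℝ) ≤ v) hlogd
    linarith
  set Q : ℝ := (K * d * (1 + 1 / γ)) ^ d with hQ
  have hbase : 1 ≤ K * d * (1 + 1 / γ) := by
    have h1 : 1 ≤ 1 + 1 / γ := by
      have : 0 < 1 / γ := by positivity
      linarith
    exact one_le_mul_of_one_le_of_one_le (one_le_mul_of_one_le_of_one_le hK hd') h1
  have hQ1 : 1 ≤ Q := one_le_pow₀ hbase
  have hlogQ : Real.log Q = d * (Real.log K + Real.log d + Real.log (1 + 1 / γ)) := by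
    rw [hQ, Real.log_pow, Real.log_mul (by positivity) (by positivity),
      Real.log_mul (by positivity) (by positivity)]
  refine pow_le_of_log_terms_le hv' hn0 hQ1 hNQ hε0 hε1 hδ0 ?_
  rw [hlogQ]
  linarith

theorem labelledRate_pos {w n : ℕ} {ε δ : ℝ} (hε0 : 0 < ε) (hδ0 : 0 < δ) (hδ1 : δ < 1) :
    0 < labelledRate w n ε δ := by
  have hlogδ : 0 < Real.log (1 / δ) := Real.log_pos (by rw [lt_div_iff₀ hδ0]; linarith)
  have hlogn := Real.log_natCast_nonneg n
  rw [labelledRate]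
  positivity

theorem labelled_sample_size {w n m : ℕ} (hw : w ≠ 0) (hn : 2 ≤ n) {c ε δ : ℝ} (hc : 448 ≤ c)
    (hε0 : 0 < ε) (hδ0 : 0 < δ) (hδ1 : δ < 1) (hm : c * polylog 1 (labelledRate w n ε δ) ≤ m) :
    ((n : ℝ) + 1) ^ w * Real.exp (-(m * ε ^ 2 / 16)) ≤ δ / 2 := by
  have hf0 := labelledRate_pos (w := w) (n := n) hε0 hδ0 hδ1
  set f := labelledRate w n ε δ with hf
  have hfε : f * ε ^ 2 = w * Real.log n + Real.log (1 / δ) := by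
    rw [hf, labelledRate, div_mul_cancel₀ _ (by positivity)]
  have hn' : (2 : ℝ) ≤ n := by exact_mod_cast hn
  have hw' : (1 : ℝ) ≤ w := by exact_mod_cast Nat.one_le_iff_ne_zero.2 hw
  have hlogδ : 0 < Real.log (1 / δ) := Real.log_pos (by rw [lt_div_iff₀ hδ0]; linarith)
  have hl := half_lt_log_two_add hf0.le
  have h1 : 224 * (f * ε ^ 2) ≤ m * ε ^ 2 := by
    rw [polylog, pow_one] at hm
    have h2 : 224 * f ≤ m := by
      have : f / 2 ≤ f * Real.log (2 + f) := by nlinarith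
      nlinarith
    nlinarith [sq_nonneg ε]
  have hlog2n : Real.log 2 ≤ Real.log n := Real.log_le_log (by norm_num) hn'
  have hlogn : 0 < Real.log n := Real.log_pos (by linarith)
  -- This is where `n ≥ 2` matters: it gives `n + 1 ≤ n ^ 2`, and also `log 2 ≤ log n` to pay for
  -- halving `δ`.
  have hlogn1 : Real.log (n + 1) ≤ 2 * Real.log n := by
    have : Real.log (n + 1) ≤ Real.log ((n : ℝ) ^ 2) :=
      Real.log_le_log (by positivity) (by nlinarith)
    rwa [Real.log_pow, Nat.cast_ofNat] at this
  have hwlog : Real.log n ≤ w * Real.log n := le_mul_of_one_le_left hlogn.le hw'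
  have hwlog1 := mul_le_mul_of_nonneg_left hlogn1 (by linarith : (0 : ℝ) ≤ w)
  rw [← Real.log_le_log_iff (by positivity) (by positivity),
    Real.log_mul (by positivity) (by positivity), Real.log_pow, Real.log_exp,
    Real.log_div (by positivity) (by norm_num)]
  rw [one_div, Real.log_inv] at *
  linarith

end SampleComplexity

/-- Local finiteness of the cover yields the countability on which measurability rests: the balls
around a countable dense set exhaust `C`. -/
theorem countable_of_finite_inter_closedBall {X : Type*} [MetricSpace X]
    [TopologicalSpace.SeparableSpace X] {C : Set X} {R : ℝ} (hR : 0 < R)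
    (hfin : ∀ x, (C ∩ Metric.closedBall x R).Finite) : C.Countable := by
  obtain ⟨s, hs, hsd⟩ := TopologicalSpace.exists_countable_dense X
  refine (hs.biUnion fun x _ => (hfin x).countable).mono fun c hc => ?_
  obtain ⟨x, hx, hcx⟩ := hsd.exists_dist_lt c hR
  exact Set.mem_biUnion hx ⟨hc, hcx.le⟩

/-- A bound on the sections of a set outside a small exceptional set bounds its measure. -/
theorem measure_prod_and_upper_integral_le {α β : Type*} [MeasurableSpace α] [MeasurableSpace β]
    (μ : Measure α) [IsProbabilityMeasure μ] (ν : Measure β) [IsProbabilityMeasure ν]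
    {S : Set (α × β)} {B : Set α} (hB : MeasurableSet B) {δ : ℝ} (hδ : 0 < δ)
    (hμB : μ B ≤ ENNReal.ofReal (δ / 2))
    (hS : ∀ a ∉ B, ν {b | (a, b) ∈ S} ≤ ENNReal.ofReal (δ / 2)) :
    (NullMeasurableSet S (μ.prod ν) → (μ.prod ν) S ≤ ENNReal.ofReal δ) ∧
      ∃ g : α → ℝ≥0∞, Measurable g ∧ (∀ a, ν {b | (a, b) ∈ S} ≤ g a) ∧
        ∫⁻ a, g a ∂μ ≤ ENNReal.ofReal δ := by
  set g : α → ℝ≥0∞ := fun a => B.indicator 1 a + ENNReal.ofReal (δ / 2) with hg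
  have hgm : Measurable g := (measurable_one.indicator hB).add_const _
  have hgS : ∀ a, ν {b | (a, b) ∈ S} ≤ g a := fun a => by
    by_cases ha : a ∈ B
    · exact prob_le_one.trans (by simp [hg, ha])
    · simpa [hg, ha] using hS a ha
  have hgint : ∫⁻ a, g a ∂μ ≤ ENNReal.ofReal δ := by
    rw [lintegral_add_right _ measurable_const, lintegral_indicator_one hB]
    calc _ ≤ ENNReal.ofReal (δ / 2) + ENNReal.ofReal (δ / 2) := by simpa using hμB
      _ = ENNReal.ofReal δ := by
        rw [← ENNReal.ofReal_add (by positivity) (by positivity), add_halves]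
  refine ⟨fun hnull => ?_, g, hgm, hgS, hgint⟩
  -- An inner measurable version keeps the measure, permits Tonelli, and only shrinks the sections.
  obtain ⟨S', hS'S, hS'm, hS'⟩ := hnull.exists_measurable_subset_ae_eq
  rw [← measure_congr hS', Measure.prod_apply hS'm]
  exact (lintegral_mono fun a => (measure_mono (μ := ν) (t := {b | (a, b) ∈ S}) fun b hb => hS'S hb).trans (hgS a)).trans hgint

end TolerantSSL

theorem mainTheorem5 :
    -- the grid of side length `2rγ/d` is an `rγ`-cover with small local cardinality
    (∀ (p : ℝ≥0∞) [Fact (1 ≤ p)] (d : ℕ), 1 ≤ d → ∀ r γ : ℝ, 0 < r → 0 < γ →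
      TolerantSSL.IsCoverOf (r * γ) (TolerantSSL.grid p d (2 * r * γ / d)) ∧
      ∀ x : TolerantSSL.Space p d,
        (TolerantSSL.discretized (TolerantSSL.ballType ((1 + γ) * r))
            (TolerantSSL.grid p d (2 * r * γ / d)) x).Finite ∧
        ((TolerantSSL.discretized (TolerantSSL.ballType ((1 + γ) * r))
            (TolerantSSL.grid p d (2 * r * γ / d)) x).ncard : ℝ)
          ≤ (2 * (d : ℝ) * (1 + 1 / γ)) ^ d) ∧
    -- the learner succeeds with every cover of this kind
    (∀ K : ℝ, 0 < K → ∃ (c : ℝ) (a : ℕ), 0 < c ∧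
      ∀ (p : ℝ≥0∞) [Fact (1 ≤ p)] (d : ℕ), 1 ≤ d → ∀ r γ : ℝ, 0 < r → 0 < γ →
      ∀ H : Set (TolerantSSL.Hypothesis (TolerantSSL.Space p d)),
      TolerantSSL.vcDim H ≠ ⊤ →
      ∀ C : Set (TolerantSSL.Space p d),
      TolerantSSL.IsCoverOf (r * γ) C →
      (∀ x : TolerantSSL.Space p d,
        (TolerantSSL.discretized (TolerantSSL.ballType ((1 + γ) * r)) C x).Finite ∧
        ((TolerantSSL.discretized (TolerantSSL.ballType ((1 + γ) * r)) C x).ncard : ℝ)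
          ≤ (K * (d : ℝ) * (1 + 1 / γ)) ^ d) →
      ∀ A : (n : ℕ) → TolerantSSL.Sample (TolerantSSL.Space p d) n →
          TolerantSSL.Hypothesis (TolerantSSL.Space p d),
      TolerantSSL.IsRERMOracle (TolerantSSL.ballType ((1 + γ) * r)) H A →
      ∀ L : (m n : ℕ) → TolerantSSL.Sample (TolerantSSL.Space p d) m →
          (Fin n → TolerantSSL.Space p d) → TolerantSSL.Hypothesis (TolerantSSL.Space p d),
      TolerantSSL.ImplementsSSL (TolerantSSL.ballType ((1 + γ) * r)) C A L →
      ∀ (P : Measure (TolerantSSL.Space p d × Bool)) [IsProbabilityMeasure P],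
      TolerantSSL.approxError (TolerantSSL.ballType ((1 + γ) * r)) P H = 0 →
      ∀ ε δ : ℝ, 0 < ε → ε < 1 → 0 < δ → δ < 1 →
      ∀ n m : ℕ,
      c * TolerantSSL.polylog a
          (TolerantSSL.unlabelledRate (TolerantSSL.vcDim H).toNat d γ ε δ) ≤ (n : ℝ) →
      c * TolerantSSL.polylog a
          (TolerantSSL.labelledRate
            (TolerantSSL.robustVCDim (TolerantSSL.ballType ((1 + γ) * r)) H).toNat n ε δ)
          ≤ (m : ℝ) →
      -- the failure probability is at most `δ`, for the joint law of the two samples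
      (NullMeasurableSet
          (TolerantSSL.failure (TolerantSSL.ballType r) (TolerantSSL.ballType ((1 + γ) * r))
            H P L ε m n)
          ((Measure.pi fun _ : Fin n => P.fst).prod (Measure.pi fun _ : Fin m => P)) →
        ((Measure.pi fun _ : Fin n => P.fst).prod (Measure.pi fun _ : Fin m => P))
          (TolerantSSL.failure (TolerantSSL.ballType r) (TolerantSSL.ballType ((1 + γ) * r))
            H P L ε m n) ≤ ENNReal.ofReal δ) ∧
      -- and, without any measurability of the learner, as an iterated upper integral
      ∃ g : (Fin n → TolerantSSL.Space p d) → ℝ≥0∞, Measurable g ∧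
        (∀ Su, (Measure.pi fun _ : Fin m => P)
          {Sl | (Su, Sl) ∈ TolerantSSL.failure (TolerantSSL.ballType r)
            (TolerantSSL.ballType ((1 + γ) * r)) H P L ε m n} ≤ g Su) ∧
        ∫⁻ Su, g Su ∂(Measure.pi fun _ : Fin n => P.fst) ≤ ENNReal.ofReal δ) := by
  refine ⟨fun p _ d hd r γ hr hγ => ?_, fun K _ => ?_⟩
  · have hd' : (1 : ℝ) ≤ d := by exact_mod_cast hd
    have hs : 2 * r * γ / d = 2 * (r * γ) / d := by ring
    refine ⟨hs ▸ TolerantSSL.isCoverOf_grid p hd (by positivity), fun x => ?_⟩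
    obtain ⟨hfin, hcard⟩ := TolerantSSL.grid_inter_closedBall_card_le p d
      (s := 2 * r * γ / d) (R := (1 + γ) * r) (by positivity) (by positivity) x
    refine ⟨hfin, hcard.trans ?_⟩
    have h1 : 2 * ((1 + γ) * r) / (2 * r * γ / d) = d * (1 + 1 / γ) := by
      field_simp
      ring
    -- This absorbs the `+ 1` of the lattice count and produces the factor 2.
    have h2 : 1 ≤ (d : ℝ) * (1 + 1 / γ) := by
      have : 0 < 1 / γ := by positivity
      nlinarith
    rw [h1]
    gcongr
    linarith
  -- Replacing `K` by `max K 1` keeps its logarithm nonnegative; a single logarithmic factor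
  -- suffices.
  · refine ⟨448 + 64 * Real.log (max K 1), 1, ?_, ?_⟩
    · have := Real.log_nonneg (le_max_right K 1)
      positivity
    intro p _ d hd r γ hr hγ H hH C hcov hC A hA L hL P _ hP ε δ hε0 hε1 hδ0 hδ1 n m hn hm
    have hlogK := Real.log_nonneg (le_max_right K 1)
    have hR : 0 < (1 + γ) * r := by positivity
    set V := TolerantSSL.ballType (X := TolerantSSL.Space p d) ((1 + γ) * r) with hV
    have hwv : TolerantSSL.robustVCDim V H ≤ TolerantSSL.vcDim H :=
      TolerantSSL.robustVCDim_le_vcDim V (fun x => Metric.mem_closedBall_self hR.le) H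
    have hw_le := ENat.toNat_le_toNat hwv hH
    have hv : TolerantSSL.vcDim H ≤ (TolerantSSL.vcDim H).toNat := (ENat.natCast_toNat hH).ge
    have hw : TolerantSSL.robustVCDim V H ≤ (TolerantSSL.robustVCDim V H).toNat :=
      (ENat.natCast_toNat (ne_top_of_le_ne_top hH hwv)).ge
    set v := (TolerantSSL.vcDim H).toNat
    set w := (TolerantSSL.robustVCDim V H).toNat
    set Q : ℝ := (max K 1 * d * (1 + 1 / γ)) ^ d with hQ
    have hCc : C.Countable :=
      TolerantSSL.countable_of_finite_inter_closedBall hR fun x => (hC x).1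
    have hN : ∀ x, (TolerantSSL.discretized V C x).ncard ≤ ⌊Q⌋₊ := fun x => by
      refine Nat.le_floor ((hC x).2.trans ?_)
      rw [hQ]
      gcongr
      exact le_max_left K 1
    obtain ⟨B, hBm, hB, hgood⟩ := TolerantSSL.exists_unlabelled_exceptional_set hCc hR.le
      (fun x => (hC x).1) hN hv hA P hP hε0 hδ0 (n := n) (by
        rcases eq_or_ne v 0 with h0 | h0
        · exact Or.inl h0
        · exact Or.inr (TolerantSSL.unlabelled_sample_size h0 hd (le_max_right K 1) hγ
            (Nat.floor_le (by positivity)) hε0 hε1 hδ0 hδ1 hn))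
    refine TolerantSSL.measure_prod_and_upper_integral_le _ _ hBm hδ0 hB fun Su hSu => ?_
    obtain ⟨h', hh', hrisk⟩ := hgood Su hSu
    have hm0 : m ≠ 0 := by
      have hf := TolerantSSL.labelledRate_pos (w := w) (n := n) hε0 hδ0 hδ1
      have hl := TolerantSSL.half_lt_log_two_add hf.le
      have : (0 : ℝ) < m := lt_of_lt_of_le (by
        rw [TolerantSSL.polylog, pow_one]
        exact mul_pos (by linarith) (mul_pos hf (by linarith))) hm
      exact_mod_cast this.ne'
    have hfail := TolerantSSL.measure_labelled_failure_le (r := r) hCc hR.le hcov (by linarith) hA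
      hL hw P hε0 hε1 hm0 (δ := δ / 2) (by
        rcases eq_or_ne w 0 with h0 | h0
        · exact Or.inl h0
        · exact Or.inr (TolerantSSL.labelled_sample_size h0
            -- From `w ≤ v` and `w ≠ 0` one gets `v ≠ 0`, which forces `n ≥ 2`.
            (TolerantSSL.two_le_of_unlabelled_sample_size (by omega) hd (by linarith) hγ hε0 hε1
              hδ0 hδ1 hn) (by linarith) hε0 hδ0 hδ1 hm)) Su hh' hrisk
    simpa only [TolerantSSL.failure, hP, zero_add, Set.mem_ofPred_eq] using hfail
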